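/- Let $X$ be a path-connected compact polyhedron and let $f_1,\dots,f_s\colon X\to S^1=\mathbb R/\mathbb Z$ be continuous maps, with classes $\alpha_i=f_i^*[S^1]\in H^1(X;\mathbb Z)$, for which there are loops $l_1,\dots,l_s\in\pi_1(X)$ with $\langle\alpha_i,l_j\rangle=\delta_{ij}$. Write $\deg g=(\langle\alpha_1,g\rangle,\dots,\langle\alpha_s,g\rangle)\in\mathbb Z^s$ for $g\in\pi_1(X)$, and let $\pi_1(X)_+\subset\pi_1(X)$ be the monoid of all $g$ with $\deg g\in\mathbb Z_{\ge0}^s$. Let $P_\pi\colon\bar X\to X$ be the covering $\{(x,r)\in X\times\mathbb R^s: r_i\equiv f_i(x) \bmod 1\ \forall i\}$ with deck group $\mathbb Z^s$, let $\bar f_i(x,r)=r_i$ be the lift of $f_i$, and let $\bar X_0=\{0\le\bar f_i\le1\ \forall i\}$ and $\bar N_0^+=\{z\in\bar X_0:\ \bar f_i(z)=1\text{ for some }i\}$. Fix a finite regular cell decomposition of $X$ (for instance a decomposition into simplices and cylinders over simplices) in which every level set $f_i^{-1}(0)$ is a subcomplex, and let $C_*$ denote cellular chains for this decomposition and its lifts.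 Let $\tilde X_+$ be the preimage of $\{\bar f_i\ge0\ \forall i\}$ in the universal covering $\tilde X$ of $X$; the monoid $\pi_1(X)_+$ acts on it. Let $\tilde E$ be a local system of free abelian groups of finite rank $k$ on $X$, with stalk $\tilde E_0\cong\mathbb Z^k$ at the base point, and let $E=\mathbb C\otimes\tilde E$. Put $P_s=\mathbb Z[t_1,\dots,t_s]$, let $g\in\pi_1(X)_+$ act from the right on $P_s^k=P_s\otimes\tilde E_0$ by multiplication with $t^{\deg g}$ tensored with the monodromy of $\tilde E$ along $g$, and let $$D_*=P_s^k\otimes_{\mathbb Z[\pi_1(X)_+]}C_*(\tilde X_+),$$ a chain complex of $P_s$-modules. For a commutative ring $K$ and $a\in K^s$ let $K_a$ be $K$ with the $P_s$-module structure in which a polynomial acts by its value at $a$. Then, for every $q\ge 0$: (1) For every $a\in(\mathbb C^*)^s$, $H_q(\mathbb C_a\otimes_{P_s}D_*)\cong H_q(X;a^\alpha\otimes E)$, where $a^\alpha$ is the flat complex line bundle whose monodromy along a loop $g$ is $\prod_i a_i^{\langle\alpha_i,g\rangle}$. Suppose moreover that $\bar N_0^+$ has a cellular collar in $\bar X_0$,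 that is, an embedding of $\bar N_0^+\times[0,\varepsilon]$ in $\bar X_0$ which is the identity on $\bar N_0^+\times0$ and which, for every open $q$-cell $e$ of $\bar N_0^+$, maps $e\times\varepsilon$ onto an open $q$-cell and $e\times(0,\varepsilon)$ onto an open $(q+1)$-cell of $\bar X$. Let $R_I$ be the complex of the cells which are the images of the $e\times\varepsilon$, and let $|R_I|\times\varepsilon\bar I\subset\bar X_0$ be the image of the whole cylinder. Then: (2) For every prime $p$, with $\mathbb Z_p$ a $P_s$-module by evaluation at $t=0$, $H_q(\mathbb Z_p\otimes_{P_s}D_*)\cong H_q(\bar X_0,|R_I|\times\varepsilon\bar I;\ \mathbb Z_p\otimes P_\pi^*\tilde E)$. (3) $H_q(\mathbb C_0\otimes_{P_s}D_*)\cong H_q(\bar X_0,|R_I|\times\varepsilon\bar I;\ P_\pi^*E)$. -/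

import Mathlib

open CategoryTheory MonoidalCategory Topology
open scoped TensorProduct DirectSum unitInterval

noncomputable section

namespace NovikovHomology

universe u w

/-! ## Finite regular cell decompositions -/

section Cells

variable (X : Type u) [TopologicalSpace X] [CWComplex (Set.univ : Set X)]

/-- The `q`-cells of the given cell decomposition of the whole space `X`. -/
abbrev Cell (q : ℕ) : Type u := RelCWComplex.cell (Set.univ : Set X) q

/-- The open cell of `X` with index `e`. -/
abbrev openCell {X : Type u} [TopologicalSpace X] [CWComplex (Set.univ : Set X)]
    {q : ℕ} (e : Cell X q) : Set X := RelCWComplex.openCell q e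

/-- The closed cell of `X` with index `e`. -/
abbrev closedCell {X : Type u} [TopologicalSpace X] [CWComplex (Set.univ : Set X)]
    {q : ℕ} (e : Cell X q) : Set X := RelCWComplex.closedCell (C := Set.univ) q e

/-- A CW decomposition is regular if the closed cells are embedded closed balls and every closed
cell is a union of open cells. Simplicial decompositions, and decompositions into simplices and
cylinders over simplices, are of this kind. -/
class IsRegularCW : Prop where
  injOn : ∀ (q : ℕ) (e : Cell X q), Set.InjOn (RelCWComplex.map q e) (Metric.closedBall 0 1)
  face : ∀ (q m : ℕ) (e : Cell X q) (e' : Cell X m),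
    (openCell e' ∩ closedCell e).Nonempty → openCell e' ⊆ closedCell e

variable {X}

/-- `e'` is a face of `e` (possibly `e` itself). -/
def IsFace {q m : ℕ} (e : Cell X q) (e' : Cell X m) : Prop := openCell e' ⊆ closedCell e

instance [RelCWComplex.Finite (Set.univ : Set X)] (q : ℕ) : Fintype (Cell X q) :=
  have : Finite (Cell X q) := RelCWComplex.FiniteType.finite_cell (C := (Set.univ : Set X)) q
  Fintype.ofFinite _

variable (X) in
/-- Incidence numbers `[e : e']` of a finite regular cell decomposition. They amount to a choice of
an orientation of every cell, and determine the cellular chain complex. -/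
structure Incidence [RelCWComplex.Finite (Set.univ : Set X)] where
  /-- The incidence number of a `(q+1)`-cell and a `q`-cell. -/
  num : ∀ {q : ℕ}, Cell X (q + 1) → Cell X q → ℤ
  num_of_face : ∀ {q : ℕ} (e : Cell X (q + 1)) (e' : Cell X q), IsFace e e' →
    num e e' = 1 ∨ num e e' = -1
  num_of_not_face : ∀ {q : ℕ} (e : Cell X (q + 1)) (e' : Cell X q), ¬ IsFace e e' → num e e' = 0
  sum_num_mul_num : ∀ {q : ℕ} (e : Cell X (q + 2)) (e'' : Cell X q),
    ∑ e' : Cell X (q + 1), num e e' * num e' e'' = 0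
  sum_num_edge : ∀ e : Cell X 1, ∑ v : Cell X 0, num e v = 0

/-- The centre of a cell, as an object of the fundamental groupoid. -/
def center {q : ℕ} (e : Cell X q) : FundamentalGroupoid X := ⟨RelCWComplex.map q e 0⟩

/-- The homotopy class of the path that runs, inside the closed cell `e`, along the radius from the
centre of `e` to the point `x`. -/
def radial {q : ℕ} (e : Cell X q) (x : FundamentalGroupoid X) (hx : x.as ∈ closedCell e) :
    center e ⟶ x :=
  Path.Homotopic.Quotient.mk
    { toFun := fun t => RelCWComplex.map q e ((t : ℝ) • hx.choose)
      continuous_toFun := by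
        refine (RelCWComplex.continuousOn q e).comp_continuous (by fun_prop) fun t => ?_
        have h := hx.choose_spec.1
        simp only [Metric.mem_closedBall, dist_zero_right] at h ⊢
        rw [norm_smul, Real.norm_eq_abs, abs_of_nonneg t.2.1]
        exact mul_le_one₀ t.2.2 (norm_nonneg _) h
      source' := by simp [center]
      target' := by simpa using hx.choose_spec.2 }

theorem center_mem {q : ℕ} (e : Cell X q) : (center e).as ∈ openCell e :=
  RelCWComplex.map_zero_mem_openCell (C := Set.univ) q e

theorem closedCell_subset [T2Space X] {q m : ℕ} {e : Cell X q} {e' : Cell X m} (h : IsFace e e') :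
    closedCell e' ⊆ closedCell e := by
  rw [closedCell, ← RelCWComplex.closure_openCell_eq_closedCell]
  exact RelCWComplex.isClosed_closedCell.closure_subset_iff.2 h

/-- The class of the radius from the centre of `e` to the centre of a face `e'`. -/
def faceHom {q m : ℕ} (e : Cell X q) (e' : Cell X m) (h : IsFace e e') : center e ⟶ center e' :=
  radial e (center e') (h (center_mem e'))

theorem IsFace.trans [T2Space X] {q m l : ℕ} {e : Cell X q} {e' : Cell X m} {e'' : Cell X l}
    (h : IsFace e e') (h' : IsFace e' e'') : IsFace e e'' := Set.Subset.trans h' (closedCell_subset h)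

/-- Two paths inside a closed cell with the same ends are homotopic. -/
theorem homotopic_of_mem_closedCell [T2Space X] [IsRegularCW X] {q : ℕ} (e : Cell X q) {x y : X}
    (γ δ : Path x y) (hγ : ∀ t, γ t ∈ closedCell e) (hδ : ∀ t, δ t ∈ closedCell e) :
    γ.Homotopic δ := by
  let B := Metric.closedBall (0 : Fin q → ℝ) 1
  let c : C(B, X) := ⟨fun b => RelCWComplex.map q e b.1,
    (RelCWComplex.continuousOn q e).comp_continuous continuous_subtype_val fun b => b.2⟩
  have hc : IsClosedEmbedding c := by
    have : CompactSpace B := isCompact_iff_compactSpace.1 (isCompact_closedBall _ _)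
    refine c.continuous.isClosedEmbedding fun a b hab => Subtype.ext ?_
    exact IsRegularCW.injOn q e a.2 b.2 hab
  have hr : ∀ z, z ∈ closedCell e → z ∈ Set.range c := by
    rintro z ⟨b, hb, rfl⟩
    exact ⟨⟨b, hb⟩, rfl⟩
  let E : B ≃ₜ Set.range c := hc.isEmbedding.toHomeomorph
  have hE : ∀ z : Set.range c, c (E.symm z) = z.1 := fun z =>
    congrArg Subtype.val (E.apply_symm_apply z)
  have : ContractibleSpace B := (convex_closedBall _ _).contractibleSpace
    ⟨0, Metric.mem_closedBall_self zero_le_one⟩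
  have hx : x ∈ closedCell e := by simpa using hγ 0
  have hy : y ∈ closedCell e := by simpa using hγ 1
  let lift : ∀ γ : Path x y, (∀ t, γ t ∈ closedCell e) →
      Path (E.symm ⟨x, hr _ hx⟩) (E.symm ⟨y, hr _ hy⟩) := fun γ hγ =>
    { toFun := fun t => E.symm ⟨γ t, hr _ (hγ t)⟩
      continuous_toFun := E.symm.continuous.comp (γ.continuous.subtype_mk _)
      source' := by simp
      target' := by simp }
  have key := (SimplyConnectedSpace.paths_homotopic (lift γ hγ) (lift δ hδ)).map c
  have hl : ∀ (γ : Path x y) (hγ : ∀ t, γ t ∈ closedCell e),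
      (lift γ hγ).map c.continuous = γ.cast (hE _) (hE _) := by
    intro γ hγ
    ext t
    exact hE _
  obtain ⟨H⟩ := key
  rw [hl γ hγ, hl δ hδ] at H
  exact ⟨H.cast rfl rfl⟩

/-- Running from the centre of `e` to the centre of a face `e'`, and then along a radius of `e'`, is
the same, up to homotopy, as running along a radius of `e`. -/
theorem radial_comp [T2Space X] [IsRegularCW X] {q m : ℕ} {e : Cell X q} {e' : Cell X m}
    (h : IsFace e e') (z : FundamentalGroupoid X) (hz : z.as ∈ closedCell e') :
    faceHom e e' h ≫ radial e' z hz = radial e z (closedCell_subset h hz) := by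
  have hrad : ∀ {q : ℕ} (e : Cell X q) (v : Fin q → ℝ) (_ : v ∈ Metric.closedBall 0 1) (t : I),
      RelCWComplex.map q e ((t : ℝ) • v) ∈ closedCell e := by
    intro q e v hv t
    refine ⟨_, ?_, rfl⟩
    simp only [Metric.mem_closedBall, dist_zero_right] at hv ⊢
    rw [norm_smul, Real.norm_eq_abs, abs_of_nonneg t.2.1]
    exact mul_le_one₀ t.2.2 (norm_nonneg _) hv
  refine Path.Homotopic.Quotient.eq.2 (homotopic_of_mem_closedCell e _ _ ?_ ?_)
  · intro t
    rw [Path.trans_apply]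
    split_ifs
    · exact hrad e _ (Exists.choose_spec (h (center_mem e'))).1 _
    · exact closedCell_subset h (hrad e' _ (Exists.choose_spec hz).1 _)
  · intro t
    exact hrad e _ (Exists.choose_spec (closedCell_subset h hz)).1 _

end Cells

/-! ## Cellular chains of a covering with local coefficients

A covering of `X` is described by its fibre functor on the fundamental groupoid of `X`, a local
system on `X` by its functor of stalks and parallel transports. -/

section Chains

variable {X : Type u} [TopologicalSpace X] [CWComplex (Set.univ : Set X)]
variable (F : FundamentalGroupoid X ⥤ Type w)

/-- The points of the covering with fibre functor `F`. -/
abbrev Total : Type (max u w) := Σ x : FundamentalGroupoid X, F.obj x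

/-- A cell of the covering lying over a cell of `X`; it is determined by its centre. -/
structure LiftedCell (q : ℕ) where
  /-- The cell of `X` below. -/
  cell : Cell X q
  /-- The centre of the lifted cell. -/
  pt : F.obj (center cell)

variable {F}

namespace LiftedCell

/-- The points of the closed lifted cell. -/
def closed {q : ℕ} (c : LiftedCell F q) : Set (Total F) :=
  {z | ∃ hz : z.1.as ∈ closedCell c.cell, F.map (radial c.cell z.1 hz) c.pt = z.2}

/-- The points of the open lifted cell. -/
def opened {q : ℕ} (c : LiftedCell F q) : Set (Total F) :=
  {z | z ∈ c.closed ∧ z.1.as ∈ openCell c.cell}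

/-- The face of a lifted cell over a face `e'` of the cell below. -/
abbrev face {q m : ℕ} (c : LiftedCell F q) (e' : Cell X m) (h : IsFace c.cell e') : LiftedCell F m :=
  ⟨e', F.map (faceHom c.cell e' h) c.pt⟩

theorem closed_face_subset [T2Space X] [IsRegularCW X] {q m : ℕ} (c : LiftedCell F q)
    (e' : Cell X m) (h : IsFace c.cell e') : (c.face e' h).closed ⊆ c.closed := by
  rintro z ⟨hz, hz'⟩
  refine ⟨closedCell_subset h hz, ?_⟩
  rw [← hz', ← radial_comp h z.1 hz]
  exact Functor.map_comp_apply F _ _ _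

theorem face_face [T2Space X] [IsRegularCW X] {q m l : ℕ} (c : LiftedCell F q)
    (e' : Cell X m) (h : IsFace c.cell e') (e'' : Cell X l) (h' : IsFace e' e'') :
    (c.face e' h).face e'' h' = c.face e'' (h.trans h') := by
  refine congrArg (LiftedCell.mk e'') ?_
  refine (Functor.map_comp_apply F _ _ _).symm.trans ?_
  exact congrArg (fun γ => F.map γ c.pt) (radial_comp h (center e'') (h' (center_mem e'')))

theorem closed_nonempty [T2Space X] {q : ℕ} (c : LiftedCell F q) : c.closed.Nonempty :=
  ⟨⟨center c.cell, F.map (radial c.cell (center c.cell)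
    (RelCWComplex.openCell_subset_closedCell _ _ (center_mem c.cell))) c.pt⟩, _, rfl⟩

/-- The lifted cell belongs to the pair `(A, B)`: it lies in `A` but not in `B`. -/
def InPair (A B : Set (Total F)) {q : ℕ} (c : LiftedCell F q) : Prop :=
  c.closed ⊆ A ∧ ¬ c.closed ⊆ B

end LiftedCell

variable {R : Type} [CommRing R] (L : FundamentalGroupoid X ⥤ ModuleCat.{0} R)
  (A B : Set (Total F))

/-- The cellular `q`-chains of the pair `(A, B)` in the covering `F`, with coefficients in the pull
back of the local system `L` to the covering: finite sums of cells in `A` but not in `B`, each with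
a coefficient in the stalk of `L` below the centre of the cell. This is the quotient of the chains
of (the largest subcomplex in) `A` by those of (the largest subcomplex in) `B`. -/
abbrev Chains (q : ℕ) : Type (max u w) :=
  ⨁ c : {c : LiftedCell F q // c.InPair A B}, L.obj (center c.1.cell)

open Classical in
/-- The chain `x · c`, for a lifted cell `c` in `(A, B)` and `x` in the stalk below its centre. -/
def single {q : ℕ} (c : LiftedCell F q) (h : c.InPair A B) :
    L.obj (center c.cell) →ₗ[R] Chains L A B q :=
  DirectSum.lof R {c : LiftedCell F q // c.InPair A B} (fun c => L.obj (center c.1.cell)) ⟨c, h⟩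

open Classical in
/-- The chain `x · c'`, where `c'` is the face of `c` over `e'` and `x` is transported from the
centre of `c` to the centre of `c'`; it is `0` if `e'` is not a face or `c'` is not in `(A, B)`. -/
def faceChain {q m : ℕ} (c : LiftedCell F q) (e' : Cell X m) :
    L.obj (center c.cell) →ₗ[R] Chains L A B m :=
  if h : IsFace c.cell e' then
    if h' : (c.face e' h).InPair A B then
      (single L A B (c.face e' h) h').comp (L.map (faceHom c.cell e' h)).hom
    else 0
  else 0

theorem single_congr {q : ℕ} {e : Cell X q} {p p' : F.obj (center e)} (hp : p = p')
    (h : LiftedCell.InPair A B ⟨e, p⟩) (h' : LiftedCell.InPair A B ⟨e, p'⟩)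
    (x : L.obj (center e)) : single L A B ⟨e, p⟩ h x = single L A B ⟨e, p'⟩ h' x := by
  subst hp
  rfl

theorem faceChain_face [T2Space X] [IsRegularCW X] {n m q : ℕ} (c : LiftedCell F n)
    (e' : Cell X m) (h : IsFace c.cell e') (e'' : Cell X q) (h' : IsFace e' e'')
    (x : L.obj (center c.cell)) :
    faceChain L A B (c.face e' h) e'' ((L.map (faceHom c.cell e' h)).hom x) =
      faceChain L A B c e'' x := by
  have hf : IsFace (c.face e' h).cell e'' := h'
  have hff := c.face_face e' h e'' h'
  rw [faceChain, faceChain, dif_pos hf, dif_pos (h.trans h')]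
  by_cases hp : (c.face e'' (h.trans h')).InPair A B
  · have hp' : ((c.face e' h).face e'' hf).InPair A B := hff ▸ hp
    rw [dif_pos hp', dif_pos hp]
    refine (single_congr L A B (eq_of_heq (LiftedCell.mk.inj hff).2) hp' hp _).trans ?_
    refine congrArg (single L A B (c.face e'' (h.trans h')) hp) ?_
    refine Eq.trans ?_ (congrArg (fun γ => (L.map γ).hom x)
      (radial_comp h (center e'') (h' (center_mem e''))))
    exact (congrArg (fun g => g.hom x)
      (L.map_comp (faceHom c.cell e' h) (faceHom e' e'' hf))).symm
  · have hp' : ¬ ((c.face e' h).face e'' hf).InPair A B := hff ▸ hp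
    rw [dif_neg hp', dif_neg hp]
    rfl

/-- Two linear maps on chains agree if they agree on the chains `x · c`. -/
theorem chains_ext {q : ℕ} {M : Type*} [AddCommGroup M] [Module R M]
    {φ ψ : Chains L A B q →ₗ[R] M}
    (h : ∀ (c : LiftedCell F q) (hc : c.InPair A B) (x : L.obj (center c.cell)),
      φ (single L A B c hc x) = ψ (single L A B c hc x)) : φ = ψ := by
  classical
  exact DirectSum.linearMap_ext R fun c => LinearMap.ext fun x => h c.1 c.2 x

variable [RelCWComplex.Finite (Set.univ : Set X)] (N : Incidence X)

open Classical in
/-- The cellular boundary operator. -/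
def boundary (q : ℕ) : Chains L A B (q + 1) →ₗ[R] Chains L A B q :=
  DirectSum.toModule R _ _ fun c =>
    ∑ e' : Cell X q, N.num c.1.cell e' • faceChain L A B c.1 e'

theorem boundary_single {q : ℕ} (c : LiftedCell F (q + 1)) (h : c.InPair A B)
    (x : L.obj (center c.cell)) : boundary L A B N q (single L A B c h x) =
      ∑ e' : Cell X q, N.num c.cell e' • faceChain L A B c e' x := by
  rw [boundary, single]
  erw [DirectSum.toModule_lof]
  rw [LinearMap.sum_apply]
  rfl

theorem boundary_faceChain [T2Space X] [IsRegularCW X] {n q : ℕ} (c : LiftedCell F n)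
    (hc : c.closed ⊆ A)
    (e' : Cell X (q + 1)) (h : IsFace c.cell e') (x : L.obj (center c.cell)) :
    boundary L A B N q (faceChain L A B c e' x) =
      ∑ e'' : Cell X q, N.num e' e'' • faceChain L A B c e'' x := by
  by_cases h' : (c.face e' h).InPair A B
  · rw [faceChain, dif_pos h, dif_pos h', LinearMap.comp_apply, boundary_single]
    refine Finset.sum_congr rfl fun e'' _ => ?_
    by_cases hf : IsFace e' e''
    · rw [faceChain_face L A B c e' h e'' hf]
    · have h0 := N.num_of_not_face _ _ hf
      rw [h0, zero_smul, zero_smul]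
  · rw [faceChain, dif_pos h, dif_neg h', LinearMap.zero_apply, map_zero]
    refine (Finset.sum_eq_zero fun e'' _ => ?_).symm
    by_cases hf : IsFace e' e''
    · have : ¬ (c.face e'' (h.trans hf)).InPair A B := by
        rw [← c.face_face e' h e'' hf]
        intro h2
        refine h' ⟨(c.closed_face_subset e' h).trans hc, fun h3 => h2.2 ?_⟩
        exact ((c.face e' h).closed_face_subset e'' hf).trans h3
      rw [faceChain, dif_pos (h.trans hf), dif_neg this, LinearMap.zero_apply, smul_zero]
    · rw [N.num_of_not_face _ _ hf, zero_smul]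

theorem boundary_boundary [T2Space X] [IsRegularCW X] (q : ℕ) :
    (boundary L A B N q).comp (boundary L A B N (q + 1)) = 0 := by
  refine chains_ext L A B fun c hc x => ?_
  rw [LinearMap.comp_apply, boundary_single, map_sum, LinearMap.zero_apply]
  have : ∀ e' : Cell X (q + 1), boundary L A B N q (N.num c.cell e' • faceChain L A B c e' x) =
        ∑ e'' : Cell X q, (N.num c.cell e' * N.num e' e'') • faceChain L A B c e'' x := by
    intro e'
    rw [map_zsmul]
    by_cases h : IsFace c.cell e'
    · rw [boundary_faceChain L A B N c hc.1 e' h x, Finset.smul_sum]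
      simp only [mul_smul]
    · simp [N.num_of_not_face _ _ h]
  refine (Finset.sum_congr rfl fun e' _ => this e').trans ?_
  rw [Finset.sum_comm]
  simp only [← Finset.sum_smul, N.sum_num_mul_num, zero_smul, Finset.sum_const_zero]

/-- The cellular chain complex of the pair `(A, B)` in the covering `F` with coefficients in the
pull back of `L`. -/
def chainComplex [T2Space X] [IsRegularCW X] : ChainComplex (ModuleCat.{max u w} R) ℕ :=
  ChainComplex.of (fun q => ModuleCat.of R (Chains L A B q))
    (fun q => ModuleCat.ofHom (boundary L A B N q)) fun q => by
      rw [← ModuleCat.ofHom_comp, boundary_boundary]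
      rfl

end Chains

/-! ## The covering attached to `s` maps to the circle -/

section Bar

variable {X : Type u} [TopologicalSpace X] {s : ℕ} (f : Fin s → C(X, UnitAddCircle))

/-- The covering `X̄ → X` on which the circle valued maps `f i` lift to real valued functions `f̄ i`:
its points are the points `x` of `X` with a real logarithm of each `f i x`. The group `ℤ ^ s` acts by
translation of the logarithms. -/
def Bar : Type u := {z : X × (Fin s → ℝ) // ∀ i, (z.2 i : UnitAddCircle) = f i z.1}

instance : TopologicalSpace (Bar f) := inferInstanceAs (TopologicalSpace (Subtype _))

variable {f} in
/-- The projection `X̄ → X`. -/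
def Bar.proj (z : Bar f) : X := z.1.1

variable {f} in
/-- The functions `f̄ i` on `X̄`. -/
def Bar.height (z : Bar f) (i : Fin s) : ℝ := z.1.2 i

theorem isCoveringMap_circle : IsCoveringMap ((↑) : ℝ → UnitAddCircle) :=
  AddCircle.isCoveringMap_coe 1

/-- The fibre of `X̄ → X`. -/
abbrev BarFibre (x : FundamentalGroupoid X) : Type :=
  {r : Fin s → ℝ // ∀ i, (r i : UnitAddCircle) = f i x.as}

variable {f} in
/-- The end point of the lift of a path to `X̄` with given starting point. -/
def barLift {x y : FundamentalGroupoid X} (γ : x ⟶ y) (r : BarFibre f x) : BarFibre f y :=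
  ⟨fun i => (isCoveringMap_circle.monodromy ((FundamentalGroupoid.map (f i)).map γ)
    ⟨r.1 i, r.2 i⟩).1, fun i => (isCoveringMap_circle.monodromy
      ((FundamentalGroupoid.map (f i)).map γ) ⟨r.1 i, r.2 i⟩).2⟩

variable {f} in
theorem barLift_id (x : FundamentalGroupoid X) (r : BarFibre f x) : barLift (𝟙 x) r = r :=
  Subtype.ext (funext fun _ =>
    congrArg Subtype.val (congrFun isCoveringMap_circle.monodromy_refl _))

variable {f} in
theorem barLift_comp {x y z : FundamentalGroupoid X} (γ : x ⟶ y) (δ : y ⟶ z) (r : BarFibre f x) :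
    barLift (γ ≫ δ) r = barLift δ (barLift γ r) :=
  Subtype.ext (funext fun i => (congrArg (fun ε => (isCoveringMap_circle.monodromy ε
    ⟨r.1 i, r.2 i⟩).1) ((FundamentalGroupoid.map (f i)).map_comp γ δ)).trans
      (congrArg Subtype.val (isCoveringMap_circle.monodromy_trans_apply _ _ _)))

/-- The fibre functor of `X̄ → X`: paths act by path lifting. -/
def barFunctor : FundamentalGroupoid X ⥤ Type where
  obj x := BarFibre f x
  map γ := ↾(barLift γ)
  map_id x := by
    ext r : 3
    exact barLift_id x r
  map_comp γ δ := by
    ext r : 3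
    exact barLift_comp γ δ r

/-- The points of the covering with fibre functor `barFunctor f` are the points of `X̄`. -/
def toBar (z : Total (barFunctor f)) : Bar f := ⟨(z.1.as, z.2.1), z.2.2⟩

variable {f}

theorem monodromy_add {x y : UnitAddCircle} (γ : Path.Homotopic.Quotient x y) {r r' : ℝ}
    (hr : (r : UnitAddCircle) = x) (hr' : (r' : UnitAddCircle) = x) (k : ℤ) (h : r' = r + k) :
    (isCoveringMap_circle.monodromy γ ⟨r', hr'⟩).1 =
      (isCoveringMap_circle.monodromy γ ⟨r, hr⟩).1 + k := by
  subst h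
  obtain ⟨γ⟩ := γ
  have hk : ∀ a : ℝ, ((a + (k : ℝ) : ℝ) : UnitAddCircle) = (a : UnitAddCircle) := by
    intro a
    have : ((k : ℝ) : UnitAddCircle) = 0 :=
      (AddCircle.coe_eq_zero_iff 1).2 ⟨k, by simp⟩
    rw [AddCircle.coe_add, this, add_zero]
  let Γ := isCoveringMap_circle.liftPath γ r (γ.source.trans hr.symm)
  have hΓ : (⟨fun t => Γ t + k, by fun_prop⟩ : C(I, ℝ)) =
      isCoveringMap_circle.liftPath γ (r + k) (γ.source.trans hr'.symm) := by
    rw [isCoveringMap_circle.eq_liftPath_iff']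
    constructor
    · funext t
      exact (hk _).trans (congrFun (isCoveringMap_circle.liftPath_lifts γ r _) t)
    · exact congrArg (· + (k : ℝ)) (isCoveringMap_circle.liftPath_zero γ r _)
  exact (congrArg (fun g : C(I, ℝ) => g 1) hΓ).symm

theorem barLift_add {x y : FundamentalGroupoid X} (γ : x ⟶ y) (r r' : BarFibre f x)
    (i : Fin s) (k : ℤ) (h : r'.1 i = r.1 i + k) :
    (barLift γ r').1 i = (barLift γ r).1 i + k :=
  monodromy_add _ _ _ _ h

theorem exists_int_barFibre {x : FundamentalGroupoid X} (r r' : BarFibre f x)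
    (i : Fin s) : ∃ k : ℤ, r'.1 i = r.1 i + k := by
  have h : ((r'.1 i - r.1 i : ℝ) : UnitAddCircle) = 0 := by
    rw [AddCircle.coe_sub, r.2 i, r'.2 i, sub_self]
  obtain ⟨k, hk⟩ := (AddCircle.coe_eq_zero_iff 1).1 h
  exact ⟨k, by simp at hk; linarith⟩

variable (f)

/-- A point of `X̄` above `x`, with logarithms in `[0, 1)`. -/
def stdPoint (x : FundamentalGroupoid X) : BarFibre f x :=
  ⟨fun i => (AddCircle.equivIco 1 0 (f i x.as)).1, fun _ => (AddCircle.equivIco 1 0).left_inv _⟩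

/-- The number of times that the lift of `f i` along a path `γ` passes through the integers, counted
with sign. On loops this is the degree of `f i ∘ γ`, that is, the value of the class of `f i`. -/
def wind {x y : FundamentalGroupoid X} (γ : x ⟶ y) (i : Fin s) : ℤ :=
  ⌊(barLift γ (stdPoint f x)).1 i⌋ - ⌊(stdPoint f x).1 i⌋

variable {f}

theorem wind_eq {x y : FundamentalGroupoid X} (γ : x ⟶ y) (r : BarFibre f x) (i : Fin s) :
    wind f γ i = ⌊(barLift γ r).1 i⌋ - ⌊r.1 i⌋ := by
  obtain ⟨k, hk⟩ := exists_int_barFibre (stdPoint f x) r i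
  rw [barLift_add γ _ _ i k hk, hk, Int.floor_add_intCast, Int.floor_add_intCast, wind]
  ring

theorem wind_id (x : FundamentalGroupoid X) (i : Fin s) : wind f (𝟙 x) i = 0 := by
  rw [wind, barLift_id, sub_self]

theorem wind_comp {x y z : FundamentalGroupoid X} (γ : x ⟶ y) (δ : y ⟶ z) (i : Fin s) :
    wind f (γ ≫ δ) i = wind f γ i + wind f δ i := by
  rw [wind_eq δ (barLift γ (stdPoint f x)), wind, wind, barLift_comp]
  ring

theorem barLift_loop {x : FundamentalGroupoid X} (γ : x ⟶ x) (r : BarFibre f x)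
    (i : Fin s) : (barLift γ r).1 i = r.1 i + wind f γ i := by
  obtain ⟨k, hk⟩ := exists_int_barFibre r (barLift γ r) i
  rw [wind_eq γ r, hk, Int.floor_add_intCast, add_sub_cancel_left]

variable (f)

/-- The flat complex line bundle `a ^ α`, whose parallel transport along a path `γ` multiplies by the
product of the `a i ^ n i`, where `n i` is the winding of `f i` along `γ`. -/
def powerSystem (a : Fin s → ℂˣ) : FundamentalGroupoid X ⥤ ModuleCat.{0} ℂ where
  obj _ := ModuleCat.of ℂ ℂ
  map γ := ModuleCat.ofHom (((∏ i, a i ^ wind f γ i : ℂˣ) : ℂ) • LinearMap.id)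
  map_id x := by
    ext
    simp [wind_id]
  map_comp γ δ := by
    ext
    simp [wind_comp, zpow_add, Finset.prod_mul_distrib, mul_comm]

end Bar

/-! ## Tensor products over the integral monoid ring of a noncommutative monoid -/

section Balanced

variable {S : Type} [CommRing S] {Γ : Type u} [Monoid Γ] {M : Type} [AddCommGroup M] [Module S M]
  (ρ : Representation S Γᵐᵒᵖ M)

/-- The relations `m g ⊗ c = m ⊗ g c`, for `g` in `Γ`. -/
def balancedRel {C : Type u} [AddCommGroup C] (τ : Representation ℤ Γ C) :
    Submodule S (M ⊗[ℤ] C) :=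
  Submodule.span S {z | ∃ (g : Γ) (m : M) (c : C),
    z = ρ (MulOpposite.op g) m ⊗ₜ[ℤ] c - m ⊗ₜ[ℤ] τ g c}

/-- The tensor product `M ⊗_{ℤ[Γ]} C` of an `(S, ℤ[Γ])`-bimodule `M` and a left `ℤ[Γ]`-module `C`,
as an `S`-module. The right action of `Γ` on `M` is a representation of `Γᵐᵒᵖ`. -/
abbrev BalancedTensor {C : Type u} [AddCommGroup C] (τ : Representation ℤ Γ C) : Type u :=
  (M ⊗[ℤ] C) ⧸ balancedRel ρ τ

/-- The map `id ⊗ φ` induced by a `ℤ[Γ]`-linear map `φ`. -/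
def balancedMap {C C' : Type u} [AddCommGroup C] [AddCommGroup C'] (τ : Representation ℤ Γ C)
    (τ' : Representation ℤ Γ C') (φ : C →ₗ[ℤ] C') (hφ : ∀ g c, φ (τ g c) = τ' g (φ c)) :
    BalancedTensor ρ τ →ₗ[S] BalancedTensor ρ τ' :=
  Submodule.mapQ _ _ (TensorProduct.AlgebraTensorModule.map LinearMap.id φ) <| by
    rw [balancedRel, Submodule.span_le]
    rintro _ ⟨g, m, c, rfl⟩
    refine Submodule.subset_span ⟨g, m, φ c, ?_⟩
    simp [hφ]

theorem balancedMap_comp_eq_zero {C C' C'' : Type u} [AddCommGroup C] [AddCommGroup C']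
    [AddCommGroup C''] (τ : Representation ℤ Γ C) (τ' : Representation ℤ Γ C')
    (τ'' : Representation ℤ Γ C'') (φ : C →ₗ[ℤ] C') (hφ : ∀ g c, φ (τ g c) = τ' g (φ c))
    (ψ : C' →ₗ[ℤ] C'') (hψ : ∀ g c, ψ (τ' g c) = τ'' g (ψ c)) (h : ψ.comp φ = 0) :
    (balancedMap ρ τ' τ'' ψ hψ).comp (balancedMap ρ τ τ' φ hφ) = 0 := by
  refine Submodule.linearMap_qext _ (TensorProduct.AlgebraTensorModule.ext fun m c => ?_)
  have hc : ψ (φ c) = 0 := congrArg (fun g => g c) h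
  simp [balancedMap, hc]

end Balanced

/-! ## The complex `D_*` -/

section Novikov

variable {X : Type u} [TopologicalSpace X] {s : ℕ} {f : Fin s → C(X, UnitAddCircle)} (z₀ : Bar f)

/-- The base point of `X`, the projection of a base point of `X̄`. -/
def base : FundamentalGroupoid X := ⟨z₀.proj⟩

/-- The base point of `X̄`, as a point of the fibre. -/
def basePoint : BarFibre f (base z₀) := ⟨z₀.1.2, z₀.2⟩

/-- The universal covering `X̃ → X`: its points above `x` are the homotopy classes of paths from the
base point to `x`. -/
def univFunctor (x₀ : FundamentalGroupoid X) : FundamentalGroupoid X ⥤ Type u where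
  obj x := x₀ ⟶ x
  map γ := ↾fun h => h ≫ γ

/-- The projection `X̃ → X̄`. -/
def univToBar (z : Total (univFunctor (base z₀))) : Bar f :=
  toBar f ⟨z.1, barLift (show base z₀ ⟶ z.1 from z.2) (basePoint z₀)⟩

/-- `X̃₊`, the preimage in `X̃` of the union of the translates of the fundamental domain
`0 ≤ f̄ i ≤ 1` of `X̄` by the nonnegative elements of `ℤ ^ s`. -/
def univPlus : Set (Total (univFunctor (base z₀))) := {z | ∀ i, 0 ≤ (univToBar z₀ z).height i}

/-- `π₁(X)`, with the product in which `g * h` is the loop `g` followed by the loop `h`. -/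
abbrev PiOne : Type u := (FundamentalGroup X z₀.proj)ᵐᵒᵖ

/-- The loop represented by an element of `π₁(X)`. -/
def PiOne.loop (g : PiOne z₀) : base z₀ ⟶ base z₀ := g.unop

variable {z₀} in
theorem PiOne.loop_one : PiOne.loop z₀ 1 = 𝟙 _ := rfl

variable {z₀} in
theorem PiOne.loop_mul (g h : PiOne z₀) :
    PiOne.loop z₀ (g * h) = PiOne.loop z₀ g ≫ PiOne.loop z₀ h := rfl

/-- The homomorphism `π₁(X) → ℤ ^ s` given by the degrees of the `f i`. -/
def PiOne.deg (g : PiOne z₀) (i : Fin s) : ℤ := wind f (PiOne.loop z₀ g) i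

/-- The monoid `π₁(X)₊` of the classes of loops all of whose degrees are nonnegative. -/
def piPlus : Submonoid (PiOne z₀) where
  carrier := {g | ∀ i, 0 ≤ PiOne.deg z₀ g i}
  one_mem' i := (wind_id (f := f) (base z₀) i).ge
  mul_mem' {g h} hg hh i := by
    rw [PiOne.deg, PiOne.loop_mul, wind_comp]
    exact add_nonneg (hg i) (hh i)

section Action

variable [CWComplex (Set.univ : Set X)]

variable {z₀} in
/-- The action of `π₁(X)` on the cells of the universal covering. -/
def actCell {q : ℕ} (g : PiOne z₀) (c : LiftedCell (univFunctor (base z₀)) q) :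
    LiftedCell (univFunctor (base z₀)) q :=
  ⟨c.cell, PiOne.loop z₀ g ≫ (show base z₀ ⟶ center c.cell from c.pt)⟩

theorem actCell_inPair {q : ℕ} (g : piPlus z₀) (c : LiftedCell (univFunctor (base z₀)) q)
    (h : c.InPair (univPlus z₀) ∅) : (actCell g.1 c).InPair (univPlus z₀) ∅ := by
  refine ⟨?_, fun h' => h.2 fun z ⟨hx, _⟩ => ?_⟩
  · rintro ⟨x, p⟩ ⟨hx, hp⟩ i
    have hp : (PiOne.loop z₀ g.1 ≫ (show base z₀ ⟶ center c.cell from c.pt)) ≫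
      radial c.cell x hx = p := hp
    let δ : base z₀ ⟶ x :=
      (show base z₀ ⟶ center c.cell from c.pt) ≫ radial c.cell x hx
    have h1 : 0 ≤ (barLift δ (basePoint z₀)).1 i :=
      h.1 (show (⟨x, δ⟩ : Total (univFunctor (base z₀))) ∈ c.closed from ⟨hx, rfl⟩) i
    have h2 : (barLift (PiOne.loop z₀ g.1 ≫ δ) (basePoint z₀)).1 i =
        (barLift δ (basePoint z₀)).1 i + PiOne.deg z₀ g.1 i := by
      rw [barLift_comp]
      exact barLift_add _ _ _ i _ (barLift_loop _ _ i)
    have h3 : 0 ≤ (barLift (PiOne.loop z₀ g.1 ≫ δ) (basePoint z₀)).1 i := by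
      rw [h2]
      exact add_nonneg h1 (Int.cast_nonneg (g.2 i))
    rw [← Category.assoc, hp] at h3
    exact h3
  · exact (h' (show (⟨z.1, (univFunctor (base z₀)).map (radial c.cell z.1 hx) (actCell g.1 c).pt⟩ :
      Total (univFunctor (base z₀))) ∈ (actCell g.1 c).closed from ⟨hx, rfl⟩)).elim

/-- The coefficients `ℤ`. -/
def constInt : FundamentalGroupoid X ⥤ ModuleCat.{0} ℤ :=
  (Functor.const _).obj (ModuleCat.of ℤ ℤ)

/-- The cellular chains of `X̃₊`. -/
abbrev PlusChains (q : ℕ) : Type u := Chains constInt (univPlus z₀) ∅ q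

open Classical in
/-- The action of `g` in `π₁(X)₊` on the chains of `X̃₊`. -/
def actChain (q : ℕ) (g : piPlus z₀) : PlusChains z₀ q →ₗ[ℤ] PlusChains z₀ q :=
  DirectSum.toModule ℤ _ _ fun c => single constInt (univPlus z₀) ∅ (actCell g.1 c.1)
    (actCell_inPair z₀ g c.1 c.2)

theorem actChain_single (q : ℕ) (g : piPlus z₀) (c : LiftedCell (univFunctor (base z₀)) q)
    (h : c.InPair (univPlus z₀) ∅) (x : ℤ) :
    actChain z₀ q g (single constInt (univPlus z₀) ∅ c h x) =
      single constInt (univPlus z₀) ∅ (actCell g.1 c) (actCell_inPair z₀ g c h) x := by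
  rw [actChain, single]
  erw [DirectSum.toModule_lof]
  rfl

/-- `C_q(X̃₊)` as a module over `ℤ[π₁(X)₊]`. -/
def chainRep (q : ℕ) : Representation ℤ (piPlus z₀) (PlusChains z₀ q) where
  toFun := actChain z₀ q
  map_one' := by
    refine chains_ext _ _ _ fun c hc x => ?_
    refine (actChain_single z₀ q 1 c hc x).trans ?_
    exact single_congr constInt (univPlus z₀) ∅ (Category.id_comp _) _ _ x
  map_mul' g h := by
    refine chains_ext _ _ _ fun c hc x => ?_
    refine (actChain_single z₀ q (g * h) c hc x).trans ?_
    refine Eq.trans ?_ (congrArg (actChain z₀ q g) (actChain_single z₀ q h c hc x)).symm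
    refine Eq.trans ?_ (actChain_single z₀ q g _ (actCell_inPair z₀ h c hc) x).symm
    exact single_congr constInt (univPlus z₀) ∅ (Category.assoc _ _ _) _ _ x

variable [T2Space X] [IsRegularCW X] [RelCWComplex.Finite (Set.univ : Set X)] (N : Incidence X)

theorem boundary_act (q : ℕ) (g : piPlus z₀) (x : PlusChains z₀ (q + 1)) :
    boundary constInt (univPlus z₀) ∅ N q (chainRep z₀ (q + 1) g x) =
      chainRep z₀ q g (boundary constInt (univPlus z₀) ∅ N q x) := by
  have key : (boundary constInt (univPlus z₀) ∅ N q).comp (actChain z₀ (q + 1) g) =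
      (actChain z₀ q g).comp (boundary constInt (univPlus z₀) ∅ N q) := by
    refine chains_ext _ _ _ fun c hc x => ?_
    have hassoc : ∀ (e' : Cell X q) (hf : IsFace c.cell e'),
        (PiOne.loop z₀ g.1 ≫ (show base z₀ ⟶ center c.cell from c.pt)) ≫ faceHom c.cell e' hf =
          PiOne.loop z₀ g.1 ≫ (show base z₀ ⟶ center c.cell from c.pt) ≫ faceHom c.cell e' hf :=
      fun e' hf => Category.assoc _ _ _
    refine (congrArg (boundary constInt (univPlus z₀) ∅ N q)
      (actChain_single z₀ (q + 1) g c hc x)).trans ?_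
    refine (boundary_single constInt (univPlus z₀) ∅ N _ (actCell_inPair z₀ g c hc) x).trans ?_
    refine Eq.trans ?_ (congrArg (actChain z₀ q g)
      (boundary_single constInt (univPlus z₀) ∅ N c hc x)).symm
    refine Eq.trans ?_ (map_sum (actChain z₀ q g) _ _).symm
    refine Finset.sum_congr rfl fun e' _ => ?_
    refine Eq.trans ?_ (map_zsmul (actChain z₀ q g) _ _).symm
    refine congrArg (N.num c.cell e' • ·) ?_
    by_cases hf : IsFace c.cell e'
    · have hf' : IsFace (actCell g.1 c).cell e' := hf
      have h1 : (c.face e' hf).InPair (univPlus z₀) ∅ :=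
        ⟨(c.closed_face_subset e' hf).trans hc.1,
          fun h => (h (c.face e' hf).closed_nonempty.some_mem).elim⟩
      have h2 : ((actCell g.1 c).face e' hf').InPair (univPlus z₀) ∅ := by
        have h3 := actCell_inPair z₀ g _ h1
        have h4 : (actCell g.1 c).face e' hf' = actCell g.1 (c.face e' hf) :=
          congrArg (LiftedCell.mk (F := univFunctor (base z₀)) e') (hassoc e' hf)
        exact h4 ▸ h3
      rw [faceChain, dif_pos hf', dif_pos h2, faceChain, dif_pos hf, dif_pos h1]
      refine Eq.trans ?_ (actChain_single z₀ q g _ h1 x).symm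
      exact single_congr constInt (univPlus z₀) ∅ (hassoc e' hf) h2 (actCell_inPair z₀ g _ h1) x
    · have hf' : ¬ IsFace (actCell g.1 c).cell e' := hf
      rw [faceChain, dif_neg hf', faceChain, dif_neg hf]
      exact (map_zero _).symm
  exact congrArg (fun φ => φ x) key

variable (E : FundamentalGroupoid X ⥤ ModuleCat.{0} ℤ)

/-- The module `P_s ⊗ E₀`, with `P_s` the ring of integral polynomials in `s` variables and `E₀` the
stalk of `E` at the base point; it is `P_s ^ k` if `E` has rank `k`. -/
abbrev Coeff : Type := MvPolynomial (Fin s) ℤ ⊗[ℤ] E.obj (base z₀)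

/-- The right action of `π₁(X)₊` on `P_s ⊗ E₀`: a loop `g` acts by the monomial with exponents the
degrees of `g` on `P_s`, and by the monodromy along `g` on `E₀`. -/
def coeffRep : Representation (MvPolynomial (Fin s) ℤ) (piPlus z₀)ᵐᵒᵖ (Coeff z₀ E) where
  toFun g := TensorProduct.AlgebraTensorModule.map
    (LinearMap.mulLeft _ (∏ i, MvPolynomial.X i ^ (PiOne.deg z₀ g.unop.1 i).toNat))
    (E.map (PiOne.loop z₀ g.unop.1)).hom
  map_one' := by
    refine TensorProduct.AlgebraTensorModule.ext fun P m => ?_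
    have h0 : ∀ i, PiOne.deg z₀ (1 : PiOne z₀) i = 0 := fun i => wind_id (f := f) (base z₀) i
    have h1 : E.map (PiOne.loop z₀ (1 : PiOne z₀)) = 𝟙 _ := E.map_id (base z₀)
    simp [h0, h1]
  map_mul' g h := by
    refine TensorProduct.AlgebraTensorModule.ext fun P m => ?_
    have h0 : ∀ i, (PiOne.deg z₀ (h.unop.1 * g.unop.1) i).toNat =
        (PiOne.deg z₀ h.unop.1 i).toNat + (PiOne.deg z₀ g.unop.1 i).toNat := fun i => by
      rw [← Int.toNat_add (h.unop.2 i) (g.unop.2 i), PiOne.deg, PiOne.loop_mul, wind_comp]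
      rfl
    have h1 : E.map (PiOne.loop z₀ (h.unop.1 * g.unop.1)) =
        E.map (PiOne.loop z₀ h.unop.1) ≫ E.map (PiOne.loop z₀ g.unop.1) := E.map_comp _ _
    simp [h0, h1, pow_add, Finset.prod_mul_distrib, mul_left_comm]

/-- The chain complex `D_* = P_s ^ k ⊗_{ℤ[π₁(X)₊]} C_*(X̃₊)` of `P_s`-modules. -/
def novikovComplex : ChainComplex (ModuleCat.{u} (MvPolynomial (Fin s) ℤ)) ℕ :=
  ChainComplex.of
    (fun q => ModuleCat.of _ (BalancedTensor (coeffRep z₀ E) (chainRep z₀ q)))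
    (fun q => ModuleCat.ofHom (balancedMap (coeffRep z₀ E) (chainRep z₀ (q + 1)) (chainRep z₀ q)
      (boundary constInt (univPlus z₀) ∅ N q) (boundary_act z₀ N q))) fun q => by
      rw [← ModuleCat.ofHom_comp, balancedMap_comp_eq_zero _ _ _ _ _ _ _ _
        (boundary_boundary constInt (univPlus z₀) ∅ N q)]
      rfl

end Action

end Novikov

/-! ## The fundamental domain, its collar, and complexes with local coefficients -/

section Domain

variable {X : Type u} [TopologicalSpace X] {s : ℕ} (f : Fin s → C(X, UnitAddCircle))

/-- The fundamental domain `X̄₀` of `X̄`, given by `0 ≤ f̄ i ≤ 1` for all `i`. -/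
def domain : Set (Bar f) := {z | ∀ i, 0 ≤ z.height i ∧ z.height i ≤ 1}

/-- The part `N̄₀⁺` of the boundary of `X̄₀` on which some `f̄ i` equals `1`. -/
def upperBoundary : Set (Bar f) := {z | z ∈ domain f ∧ ∃ i, z.height i = 1}

variable [CWComplex (Set.univ : Set X)]

/-- A cellular collar of `N̄₀⁺` in `X̄₀`: an embedded cylinder `N̄₀⁺ × [0, ε]` with bottom `N̄₀⁺`, such
that the push `e × ε` of every cell `e` of `N̄₀⁺` is a cell of the same dimension (these cells form
`R_I`), and the cylinder `e × (0, ε)` is a cell of one dimension more. -/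
structure Collar where
  /-- The height of the cylinder. -/
  ε : ℝ
  ε_pos : 0 < ε
  /-- The parametrization of the collar. -/
  map : upperBoundary f × Set.Icc (0 : ℝ) ε → Bar f
  isEmbedding : IsEmbedding map
  map_mem : ∀ p, map p ∈ domain f
  map_zero : ∀ z, map (z, ⟨0, le_rfl, ε_pos.le⟩) = z.1
  /-- The cells of `R_I`. -/
  top : ∀ (q : ℕ) (c : LiftedCell (barFunctor f) q), toBar f '' c.opened ⊆ upperBoundary f →
    ∃ c' : LiftedCell (barFunctor f) q,
      toBar f '' c'.opened = map '' {p | p.1.1 ∈ toBar f '' c.opened ∧ p.2.1 = ε}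
  /-- The cylindrical cells. -/
  cylinder : ∀ (q : ℕ) (c : LiftedCell (barFunctor f) q),
    toBar f '' c.opened ⊆ upperBoundary f →
    ∃ c' : LiftedCell (barFunctor f) (q + 1),
      toBar f '' c'.opened =
        map '' {p | p.1.1 ∈ toBar f '' c.opened ∧ 0 < p.2.1 ∧ p.2.1 < ε}

variable {f} in
/-- The collar `|R_I| × ε Ī`, as a subset of `X̄₀`. -/
def Collar.carrier (κ : Collar f) : Set (Bar f) := Set.range κ.map

variable [RelCWComplex.Finite (Set.univ : Set X)] [T2Space X] [IsRegularCW X] (N : Incidence X)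
  {R : Type} [CommRing R]

/-- The cellular chain complex of `X` with coefficients in the local system `L`. -/
def localComplex (L : FundamentalGroupoid X ⥤ ModuleCat.{0} R) :
    ChainComplex (ModuleCat.{u} R) ℕ :=
  chainComplex (F := (Functor.const _).obj PUnit.{1}) L Set.univ ∅ N

/-- The cellular chain complex of a pair of subspaces of `X̄` with coefficients in the pull back of
the local system `L` on `X`. -/
def barComplex (L : FundamentalGroupoid X ⥤ ModuleCat.{0} R) (A B : Set (Bar f)) :
    ChainComplex (ModuleCat.{u} R) ℕ :=
  chainComplex (F := barFunctor f) L (toBar f ⁻¹' A) (toBar f ⁻¹' B) N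

/-- The local system `K ⊗ E`. -/
def scalarSystem (K : Type) [CommRing K] (E : FundamentalGroupoid X ⥤ ModuleCat.{0} ℤ) :
    FundamentalGroupoid X ⥤ ModuleCat.{0} K :=
  E ⋙ ModuleCat.extendScalars (Int.castRingHom K)

variable {f} in
/-- The complex `K_a ⊗_{P_s} D_*`, where `K_a` is `K` with the `P_s`-module structure in which a
polynomial acts by its value at `a`. -/
def evalComplex (z₀ : Bar f) (E : FundamentalGroupoid X ⥤ ModuleCat.{0} ℤ) (K : Type) [CommRing K]
    (a : Fin s → K) : ChainComplex (ModuleCat.{u} K) ℕ :=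
  ((ModuleCat.extendScalars (MvPolynomial.eval₂Hom (Int.castRingHom K) a)).mapHomologicalComplex
    (ComplexShape.down ℕ)).obj (novikovComplex z₀ N E)

end Domain

end NovikovHomology

end

/-!
The modules of `D_*` are free over `P_s = ℤ[t]`: choosing in each orbit of cells of `X̃₊` the one
whose heights have integral lower bounds `0`, one finds `D_q ≅ ⨁ P_s ⊗ E_e`, with one summand for
each `q`-cell `e` of `X`. A cell of `X̃₊` with lower bounds `n` is `t ^ n` times the chosen one, and
the boundary of the chosen lift of `e` contains the chosen lift of a face `e'` with the weight
`t ^ wind`, where the windings of the radius from the centre of `e` to the centre of `e'` are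
nonnegative. This uses that the zero sets of the `f i` are subcomplexes, so that on a lifted cell
every height stays between two consecutive integers (`LiftedCell.height_dichotomy`).

Hence `K_a ⊗ D_*` is the complex `⨁ K ⊗ E_e` with the weights `a ^ wind`. Any complex of a pair in a
covering of `X` that contains exactly one lift of each cell, with these weights, is isomorphic to it
(`SpecializationModel.complexIso`). There are two such models. If `a` is invertible, the weights
are the transports of the flat line bundle `a ^ α`, which gives the complex of `X` with coefficients
in `a ^ α ⊗ E` (`torusModel`). If `a = 0`, exactly those faces survive for which all windings
vanish. These are the faces of the cells of the fundamental domain `X̄₀` that do not lie in `N̄₀⁺`, so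
that one gets the complex of the pair `(X̄₀, N̄₀⁺)`, over every ring `K` (`originModel`).

It remains to replace `N̄₀⁺` by its collar. The cells of the collar outside `N̄₀⁺` come in pairs: the
push `e × ε` of a cell `e` of `N̄₀⁺` is a face of the cylinder `e × (0, ε)`, with incidence number
`±1`, and of no other cylinder. Such a perfect matching makes the relative complex of the collar
modulo `N̄₀⁺` acyclic (`IsMatching.exact`, `Collar.acyclic`), and the long exact sequence of the
triple `N̄₀⁺ ⊆ |R_I| × ε Ī ⊆ X̄₀` finishes the proof (`Collar.nonempty_homology_iso`).
-/

open scoped TensorProduct DirectSum unitInterval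

noncomputable section

namespace NovikovHomology

universe u w

/-! ### Lifted cells and the heights on them -/

section LiftedCells

variable {X : Type u} [TopologicalSpace X] [CWComplex (Set.univ : Set X)]

theorem openCell_subset_closedCell {q : ℕ} (e : Cell X q) : openCell e ⊆ closedCell e :=
  RelCWComplex.openCell_subset_closedCell _ _

theorem exists_mem_openCell (x : X) : ∃ (q : ℕ) (e : Cell X q), x ∈ openCell e := by
  have h : x ∈ ⋃ (n : ℕ) (j : Cell X n), openCell j := by
    rw [CWComplex.iUnion_openCell_eq_complex (C := (Set.univ : Set X))]
    exact Set.mem_univ x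
  simpa using h

theorem choose_eq_of_map_eq [IsRegularCW X] {q : ℕ} (e : Cell X q) {x : X} (hx : x ∈ closedCell e)
    {b : Fin q → ℝ} (hb : b ∈ Metric.closedBall 0 1) (h : RelCWComplex.map q e b = x) :
    hx.choose = b :=
  IsRegularCW.injOn q e hx.choose_spec.1 hb (hx.choose_spec.2.trans h.symm)

theorem smul_mem_ball {q : ℕ} {b : Fin q → ℝ} (hb : b ∈ Metric.closedBall 0 1) (t : I)
    (h : t < 1 ∨ b ∈ Metric.ball 0 1) : (t : ℝ) • b ∈ Metric.ball (0 : Fin q → ℝ) 1 := by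
  simp only [Metric.mem_closedBall, Metric.mem_ball, dist_zero_right] at hb h ⊢
  rw [norm_smul, Real.norm_eq_abs, abs_of_nonneg t.2.1]
  have h0 := norm_nonneg b
  have h1 := t.2.1
  have h2 := t.2.2
  rcases h with h | h
  · have : (t : ℝ) < 1 := h
    nlinarith
  · nlinarith

theorem smul_mem_closedBall {q : ℕ} {b : Fin q → ℝ} (hb : b ∈ Metric.closedBall 0 1) (t : I) :
    (t : ℝ) • b ∈ Metric.closedBall (0 : Fin q → ℝ) 1 := by
  simp only [Metric.mem_closedBall, dist_zero_right] at hb ⊢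
  rw [norm_smul, Real.norm_eq_abs, abs_of_nonneg t.2.1]
  exact mul_le_one₀ t.2.2 (norm_nonneg _) hb

/-- The radius from the centre of a regular cell to its centre is constant. -/
theorem radial_center [IsRegularCW X] {q : ℕ} (e : Cell X q) (h : (center e).as ∈ closedCell e) :
    radial e (center e) h = 𝟙 _ := by
  have h0 : h.choose = 0 := choose_eq_of_map_eq e h (by simp) rfl
  refine congrArg Path.Homotopic.Quotient.mk (a₂ := Path.refl _) (Path.ext (funext fun t => ?_))
  change RelCWComplex.map q e ((t : ℝ) • h.choose) = RelCWComplex.map q e 0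
  rw [h0, smul_zero]

namespace LiftedCell

section General

variable {F : FundamentalGroupoid X ⥤ Type w}

theorem center_mem_opened [IsRegularCW X] {q : ℕ} (c : LiftedCell F q) :
    (⟨center c.cell, c.pt⟩ : Total F) ∈ c.opened := by
  refine ⟨⟨openCell_subset_closedCell _ (center_mem c.cell), ?_⟩, center_mem c.cell⟩
  change F.map _ c.pt = c.pt
  rw [radial_center, F.map_id]
  rfl

/-- Two lifted cells which meet are equal. -/
theorem eq_of_mem_opened {q m : ℕ} {c : LiftedCell F q} {c' : LiftedCell F m} {z : Total F}
    (h : z ∈ c.opened) (h' : z ∈ c'.opened) :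
    (⟨q, c⟩ : Σ n, LiftedCell F n) = ⟨m, c'⟩ := by
  obtain ⟨e, p⟩ := c
  obtain ⟨e', p'⟩ := c'
  have he : (⟨q, e⟩ : Σ n, Cell X n) = ⟨m, e'⟩ := by
    refine RelCWComplex.eq_of_not_disjoint_openCell (C := (Set.univ : Set X)) fun hd => ?_
    exact Set.disjoint_left.1 hd h.2 h'.2
  obtain ⟨rfl, he⟩ := Sigma.mk.inj he
  obtain rfl := eq_of_heq he
  obtain ⟨⟨hz, hp⟩, -⟩ := h
  obtain ⟨⟨hz', hp'⟩, -⟩ := h'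
  have hi : Function.Injective (F.map (radial e z.1 hz)) :=
    ((isIso_iff_bijective _).1 inferInstance).1
  have h : p = p' := hi (hp.trans hp'.symm)
  rw [h]

theorem cell_eq_of_mem_opened {q : ℕ} {c c' : LiftedCell F q} {z : Total F}
    (h : z ∈ c.opened) (h' : z ∈ c'.opened) : c = c' :=
  eq_of_heq (Sigma.mk.inj (eq_of_mem_opened h h')).2

theorem exists_mem_opened (z : Total F) : ∃ (q : ℕ) (c : LiftedCell F q), z ∈ c.opened := by
  obtain ⟨q, e, he⟩ := exists_mem_openCell z.1.as
  have hz : z.1.as ∈ closedCell e := openCell_subset_closedCell e he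
  refine ⟨q, ⟨e, F.map (inv (radial e z.1 hz)) z.2⟩, ⟨hz, ?_⟩, he⟩
  refine (Functor.map_comp_apply F _ _ _).symm.trans ?_
  rw [IsIso.inv_hom_id, F.map_id]
  rfl

/-- A cell lying in the closure of a cell of the same dimension is equal to it. -/
theorem eq_of_mem_closed [T2Space X] {q : ℕ} {c c' : LiftedCell F q} {z : Total F}
    (h : z ∈ c.closed) (h' : z ∈ c'.opened) : c = c' := by
  refine cell_eq_of_mem_opened ⟨h, ?_⟩ h'
  obtain ⟨hz, -⟩ := h
  rw [closedCell, ← RelCWComplex.cellFrontier_union_openCell_eq_closedCell] at hz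
  refine hz.resolve_left fun hz => ?_
  have h1 := RelCWComplex.cellFrontier_subset_skeletonLT (C := (Set.univ : Set X)) q c.cell hz
  have h2 := RelCWComplex.disjoint_skeletonLT_openCell (C := (Set.univ : Set X)) (n := q)
    (j := c'.cell) le_rfl
  exact Set.disjoint_left.1 h2 h1 h'.2

/-- A cell with a point in a closed cell is a face of it. -/
theorem exists_face_eq [IsRegularCW X] [T2Space X] {q m : ℕ} {c : LiftedCell F q}
    {c' : LiftedCell F m} {z : Total F} (hz : z ∈ c'.opened) (h : z ∈ c.closed) :
    ∃ h : IsFace c.cell c'.cell, c.face c'.cell h = c' := by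
  have hf : IsFace c.cell c'.cell := IsRegularCW.face _ _ _ _ ⟨z.1.as, hz.2, h.1⟩
  refine ⟨hf, cell_eq_of_mem_opened (z := z) ⟨⟨hz.1.1, ?_⟩, hz.2⟩ hz⟩
  refine (Functor.map_comp_apply F _ _ _).symm.trans ?_
  rw [radial_comp]
  exact h.2

end General

variable {s : ℕ} {f : Fin s → C(X, UnitAddCircle)}

/-- The lift of `f i` along the radii of a lifted cell of `X̄`: the value at `(t, b)` is the height of
the point at time `t` on the radius that ends in the point of the cell with coordinate `b`. -/
def heightLift {q : ℕ} (c : LiftedCell (barFunctor f) q) (i : Fin s) :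
    C(I × Metric.closedBall (0 : Fin q → ℝ) 1, ℝ) :=
  isCoveringMap_circle.liftHomotopy
    ⟨fun p => f i (RelCWComplex.map q c.cell ((p.1 : ℝ) • p.2.1)),
      (f i).continuous.comp ((RelCWComplex.continuousOn q c.cell).comp_continuous (by fun_prop)
        fun p => smul_mem_closedBall p.2.2 p.1)⟩
    (ContinuousMap.const _ (c.pt.1 i)) fun b => by
      simp only [ContinuousMap.coe_mk, Set.Icc.coe_zero, zero_smul]
      exact (c.pt.2 i).symm

theorem coe_heightLift {q : ℕ} (c : LiftedCell (barFunctor f) q) (i : Fin s) (t : I)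
    (b : Metric.closedBall (0 : Fin q → ℝ) 1) :
    (heightLift c i (t, b) : UnitAddCircle) = f i (RelCWComplex.map q c.cell ((t : ℝ) • b.1)) :=
  congrFun (isCoveringMap_circle.liftHomotopy_lifts _ _ _) (t, b)

theorem heightLift_zero {q : ℕ} (c : LiftedCell (barFunctor f) q) (i : Fin s)
    (b : Metric.closedBall (0 : Fin q → ℝ) 1) : heightLift c i (0, b) = c.pt.1 i :=
  isCoveringMap_circle.liftHomotopy_zero _ _ _ b

theorem barLift_radial {q : ℕ} (c : LiftedCell (barFunctor f) q) (x : FundamentalGroupoid X)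
    (hx : x.as ∈ closedCell c.cell) (i : Fin s) :
    (barLift (radial c.cell x hx) c.pt).1 i = heightLift c i (1, ⟨hx.choose, hx.choose_spec.1⟩) :=
  rfl

/-- The characteristic map of a lifted cell of `X̄`. -/
def charMap {q : ℕ} (c : LiftedCell (barFunctor f) q) (b : Metric.closedBall (0 : Fin q → ℝ) 1) :
    Bar f :=
  ⟨(RelCWComplex.map q c.cell b.1, fun i => heightLift c i (1, b)), fun i => by
    rw [coe_heightLift, Set.Icc.coe_one, one_smul]⟩

theorem continuous_charMap {q : ℕ} (c : LiftedCell (barFunctor f) q) : Continuous c.charMap := by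
  refine Continuous.subtype_mk (Continuous.prodMk ?_ (continuous_pi fun i => ?_)) _
  · exact (RelCWComplex.continuousOn q c.cell).comp_continuous continuous_subtype_val fun b => b.2
  · exact (heightLift c i).continuous.comp (by fun_prop)

variable [IsRegularCW X]

theorem toBar_image_closed {q : ℕ} (c : LiftedCell (barFunctor f) q) :
    toBar f '' c.closed = Set.range c.charMap := by
  ext z
  constructor
  · rintro ⟨⟨x, r⟩, ⟨hx, hr⟩, rfl⟩
    refine ⟨⟨hx.choose, hx.choose_spec.1⟩, Subtype.ext (Prod.ext hx.choose_spec.2 ?_)⟩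
    exact funext fun i => (barLift_radial c x hx i).symm.trans (congrArg (fun r => r.1 i) hr)
  · rintro ⟨b, rfl⟩
    have hx : RelCWComplex.map q c.cell b.1 ∈ closedCell c.cell := ⟨b.1, b.2, rfl⟩
    refine ⟨⟨⟨RelCWComplex.map q c.cell b.1⟩, barLift (radial c.cell _ hx) c.pt⟩, ⟨hx, rfl⟩, ?_⟩
    refine Subtype.ext (Prod.ext rfl (funext fun i => ?_))
    refine (barLift_radial c _ hx i).trans (congrArg (fun b => heightLift c i (1, b)) ?_)
    exact Subtype.ext (choose_eq_of_map_eq c.cell hx b.2 rfl)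

theorem toBar_image_opened {q : ℕ} (c : LiftedCell (barFunctor f) q) :
    toBar f '' c.opened = c.charMap '' {b | b.1 ∈ Metric.ball 0 1} := by
  ext z
  constructor
  · rintro ⟨z, ⟨hz, hz'⟩, rfl⟩
    obtain ⟨b, hb⟩ : toBar f z ∈ Set.range c.charMap := by
      rw [← toBar_image_closed]
      exact ⟨z, hz, rfl⟩
    refine ⟨b, ?_, hb⟩
    obtain ⟨b', hb', hbz⟩ := hz'
    have h1 : RelCWComplex.map q c.cell b.1 = z.1.as := congrArg (fun z => z.1.1) hb
    have h2 := IsRegularCW.injOn q c.cell b.2 (Metric.ball_subset_closedBall hb')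
      (h1.trans hbz.symm)
    exact show b.1 ∈ Metric.ball 0 1 from h2 ▸ hb'
  · rintro ⟨b, hb, rfl⟩
    obtain ⟨z, hz, hzb⟩ : c.charMap b ∈ toBar f '' c.closed := by
      rw [toBar_image_closed]
      exact ⟨b, rfl⟩
    refine ⟨z, ⟨hz, ?_⟩, hzb⟩
    have h1 : z.1.as = RelCWComplex.map q c.cell b.1 := congrArg (fun z => z.1.1) hzb
    rw [h1]
    exact ⟨b.1, hb, rfl⟩

omit [CWComplex (Set.univ : Set X)] [IsRegularCW X] in
theorem toBar_injective : Function.Injective (toBar f) := by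
  rintro ⟨⟨x⟩, r, hr⟩ ⟨⟨y⟩, t, ht⟩ h
  obtain ⟨h1, h2⟩ := Prod.mk.inj (congrArg Subtype.val h)
  change x = y at h1
  change r = t at h2
  subst h1 h2
  rfl

/-- On the points of a closed cell of `X̄`, the height `f̄ i` stays in an interval `[n, n + 1]` between
consecutive integers; if it takes an integral value on the open cell, then it is constant. -/
theorem height_dichotomy
    (hN : ∀ (i : Fin s) (q : ℕ) (e : Cell X q), (openCell e ∩ f i ⁻¹' {0}).Nonempty →
      openCell e ⊆ f i ⁻¹' {0})
    {q : ℕ} (c : LiftedCell (barFunctor f) q) (i : Fin s) :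
    (∀ z ∈ c.closed, (toBar f z).height i = ⌊c.pt.1 i⌋) ∨
      ((∀ z ∈ c.closed, ⌊c.pt.1 i⌋ ≤ (toBar f z).height i ∧
          (toBar f z).height i ≤ ⌊c.pt.1 i⌋ + 1) ∧
        ∀ z ∈ c.opened, ⌊c.pt.1 i⌋ < (toBar f z).height i ∧
          (toBar f z).height i < ⌊c.pt.1 i⌋ + 1) := by
  have hcoe : ∀ x : ℝ, (x : UnitAddCircle) = 0 ↔ ∃ n : ℤ, (n : ℝ) = x := fun x => by
    rw [AddCircle.coe_eq_zero_iff]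
    simp
  have hopen : ∀ (t : I) (b : Metric.closedBall (0 : Fin q → ℝ) 1),
      (t < 1 ∨ b.1 ∈ Metric.ball 0 1) →
      RelCWComplex.map q c.cell ((t : ℝ) • b.1) ∈ openCell c.cell := fun t b h =>
    ⟨_, smul_mem_ball b.2 t h, rfl⟩
  by_cases h0 : openCell c.cell ⊆ f i ⁻¹' {0}
  -- If `f i` vanishes on the open cell, then it vanishes on the closed cell, and its lift along
  -- every radius is constant.
  · left
    have hpt : (c.pt.1 i : UnitAddCircle) = 0 := (c.pt.2 i).trans (h0 (center_mem c.cell))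
    obtain ⟨n, hn⟩ := (hcoe _).1 hpt
    intro z hz
    have hz' : toBar f z ∈ toBar f '' c.closed := ⟨z, hz, rfl⟩
    rw [toBar_image_closed] at hz'
    obtain ⟨b, hb⟩ := hz'
    have hcl : closedCell c.cell ⊆ f i ⁻¹' {0} := by
      have hc : IsClosed (f i ⁻¹' {0}) := isClosed_singleton.preimage (f i).continuous
      rintro _ ⟨b, hb, rfl⟩
      rw [← closure_ball (0 : Fin q → ℝ) one_ne_zero] at hb
      have h1 : ContinuousWithinAt (RelCWComplex.map q c.cell) (Metric.ball 0 1) b :=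
        (RelCWComplex.continuousOn q c.cell b (by rwa [← closure_ball _ one_ne_zero])).mono
          Metric.ball_subset_closedBall
      have h2 := h1.mem_closure_image hb
      exact hc.closure_subset_iff.2 h0 h2
    have hconst : (fun _ : I => c.pt.1 i) = isCoveringMap_circle.liftPath
        ⟨fun t : I => f i (RelCWComplex.map q c.cell ((t : ℝ) • b.1)),
          (f i).continuous.comp ((RelCWComplex.continuousOn q c.cell).comp_continuous (by fun_prop)
            fun t => smul_mem_closedBall b.2 t)⟩ (c.pt.1 i) (by
              simp only [ContinuousMap.coe_mk, Set.Icc.coe_zero, zero_smul]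
              exact (c.pt.2 i).symm) := by
      rw [isCoveringMap_circle.eq_liftPath_iff]
      refine ⟨continuous_const, funext fun t => ?_, rfl⟩
      exact hpt.trans (hcl ⟨_, smul_mem_closedBall b.2 t, rfl⟩ : _ = _).symm
    have h1 : heightLift c i (1, b) = c.pt.1 i := (congrFun hconst 1).symm
    rw [← hb]
    change heightLift c i (1, b) = _
    rw [h1, ← hn, Int.floor_intCast]
  -- Otherwise the lift takes no integral value on the open cell, and therefore stays between two
  -- consecutive integers along every radius, by the intermediate value theorem.
  · right
    have hne : ∀ (t : I) (b : Metric.closedBall (0 : Fin q → ℝ) 1),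
        (t < 1 ∨ b.1 ∈ Metric.ball 0 1) → ∀ n : ℤ, (n : ℝ) ≠ heightLift c i (t, b) := by
      intro t b h n hn
      refine h0 (hN i q c.cell ⟨_, hopen t b h, ?_⟩)
      refine (coe_heightLift c i t b).symm.trans ?_
      exact (hcoe _).2 ⟨n, hn⟩
    have hcont : ∀ b, Continuous fun t : I => heightLift c i (t, b) := fun b =>
      (heightLift c i).continuous.comp (by fun_prop)
    have hst : ∀ (t : I) (b : Metric.closedBall (0 : Fin q → ℝ) 1),
        (t < 1 ∨ b.1 ∈ Metric.ball 0 1) → ⌊c.pt.1 i⌋ < heightLift c i (t, b) ∧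
          heightLift c i (t, b) < ⌊c.pt.1 i⌋ + 1 := by
      intro t b h
      have hlt : ∀ t' : I, t' ∈ Set.Icc 0 t → (t' < 1 ∨ b.1 ∈ Metric.ball 0 1) := fun t' ht' =>
        h.imp (ht'.2.trans_lt ·) id
      have hz := heightLift_zero c i b
      constructor
      · by_contra! hle
        obtain ⟨t', ht', he⟩ := intermediate_value_Icc' (show (0 : I) ≤ t from t.2.1)
          (hcont b).continuousOn ⟨hle, by simpa only [hz] using Int.floor_le (c.pt.1 i)⟩
        exact hne t' b (hlt t' ht') _ he.symm
      · by_contra! hle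
        obtain ⟨t', ht', he⟩ := intermediate_value_Icc (show (0 : I) ≤ t from t.2.1)
          (hcont b).continuousOn
            ⟨by simpa only [hz] using (Int.lt_floor_add_one (c.pt.1 i)).le, hle⟩
        refine hne t' b (hlt t' ht') (⌊c.pt.1 i⌋ + 1) ?_
        push_cast
        exact he.symm
    constructor
    · intro z hz
      have hz' : toBar f z ∈ toBar f '' c.closed := ⟨z, hz, rfl⟩
      rw [toBar_image_closed] at hz'
      obtain ⟨b, hb⟩ := hz'
      have h1 : (1 : I) ∈ closure (Set.Iio (1 : I)) := by
        rw [closure_Iio' ⟨0, zero_lt_one⟩]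
        exact Set.mem_Iic.2 le_rfl
      have h2 := map_mem_closure (hcont b) h1
        (t := Set.Icc (⌊c.pt.1 i⌋ : ℝ) (⌊c.pt.1 i⌋ + 1)) fun t ht =>
          ⟨(hst t b (.inl ht)).1.le, (hst t b (.inl ht)).2.le⟩
      rw [isClosed_Icc.closure_eq] at h2
      rw [← hb]
      exact h2
    · intro z hz
      have hz' : toBar f z ∈ toBar f '' c.opened := ⟨z, hz, rfl⟩
      rw [toBar_image_opened] at hz'
      obtain ⟨b, hb, hbz⟩ := hz'
      rw [← hbz]
      exact hst 1 b (.inr hb)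

variable [T2Space X]

omit [CWComplex (Set.univ : Set X)] [IsRegularCW X] in
instance : T2Space (Bar f) := inferInstanceAs (T2Space (Subtype _))

omit [T2Space X] in
theorem isCompact_toBar_image_closed {q : ℕ} (c : LiftedCell (barFunctor f) q) :
    IsCompact (toBar f '' c.closed) := by
  have : CompactSpace (Metric.closedBall (0 : Fin q → ℝ) 1) :=
    isCompact_iff_compactSpace.1 (isCompact_closedBall _ _)
  rw [toBar_image_closed]
  exact isCompact_range c.continuous_charMap

omit [IsRegularCW X] [T2Space X] in
theorem opened_subset_closed {q : ℕ} (c : LiftedCell (barFunctor f) q) : c.opened ⊆ c.closed :=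
  fun _ h => h.1

/-- The closed cells of `X̄` are the closures of the open cells. -/
theorem toBar_image_closed_eq_closure {q : ℕ} (c : LiftedCell (barFunctor f) q) :
    toBar f '' c.closed = closure (toBar f '' c.opened) := by
  refine subset_antisymm ?_ ((c.isCompact_toBar_image_closed.isClosed.closure_subset_iff).2
    (Set.image_mono c.opened_subset_closed))
  rw [toBar_image_closed, toBar_image_opened]
  rintro _ ⟨b, rfl⟩
  refine map_mem_closure c.continuous_charMap ?_ fun b hb => ⟨b, hb, rfl⟩
  refine closure_subtype.2 ?_
  have h : Subtype.val '' {b : Metric.closedBall (0 : Fin q → ℝ) 1 | b.1 ∈ Metric.ball 0 1} =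
      Metric.ball 0 1 := by
    ext x
    exact ⟨fun ⟨b, hb, h⟩ => h ▸ hb, fun h => ⟨⟨x, Metric.ball_subset_closedBall h⟩, h, rfl⟩⟩
  rw [h, closure_ball _ one_ne_zero]
  exact b.2

end LiftedCell

end LiftedCells

/-! ### Cancelling matched pairs of cells -/

section Matching

variable {R : Type*} [CommRing R] {ι κ : Type*} {V : ι → Type*} {W : κ → Type*}
  [∀ i, AddCommGroup (V i)] [∀ i, Module R (V i)] [∀ j, AddCommGroup (W j)] [∀ j, Module R (W j)]

open Classical in
/-- The linear map `d` is a *matching* along the relation `m` if, on matched summands, its matrix is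
diagonal with bijective entries. -/
structure IsMatching (d : (⨁ j, W j) →ₗ[R] ⨁ i, V i) (m : ι → κ → Prop) : Prop where
  functional : ∀ {i j j'}, m i j → m i j' → j = j'
  bijective : ∀ {i j}, m i j → Function.Bijective fun x => d (DirectSum.lof R κ W j x) i
  off_diagonal : ∀ {i i' j j'}, m i j → m i' j' → i' ≠ i →
    ∀ x, d (DirectSum.lof R κ W j x) i' = 0

/-- Every chain agrees with a boundary on the matched targets. -/
theorem IsMatching.exists_agree {d : (⨁ j, W j) →ₗ[R] ⨁ i, V i} {m : ι → κ → Prop}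
    (h : IsMatching d m) (z : ⨁ i, V i) : ∃ w, ∀ i j, m i j → d w i = z i := by
  classical
  induction z using DirectSum.induction_on with
  | zero => exact ⟨0, fun i j _ => by rw [map_zero]⟩
  | of i x =>
    by_cases hi : ∃ j, m i j
    · obtain ⟨j, hj⟩ := hi
      obtain ⟨y, hy⟩ := (h.bijective hj).2 x
      refine ⟨DirectSum.lof R κ W j y, fun i' j' hij => ?_⟩
      by_cases hne : i' = i
      · subst hne
        rw [DirectSum.of_eq_same]
        convert hy
      · rw [DirectSum.of_eq_of_ne _ _ _ hne]
        convert h.off_diagonal hj hij hne y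
    · refine ⟨0, fun i' j' hij => ?_⟩
      have hne : i' ≠ i := fun he => hi ⟨j', he ▸ hij⟩
      rw [DirectSum.of_eq_of_ne _ _ _ hne, map_zero, DirectSum.zero_apply]
  | add x y hx hy =>
    obtain ⟨w, hw⟩ := hx
    obtain ⟨w', hw'⟩ := hy
    refine ⟨w + w', fun i j hij => ?_⟩
    rw [map_add, DirectSum.add_apply, DirectSum.add_apply, hw i j hij, hw' i j hij]

/-- A matching is injective on the chains supported on matched sources. -/
theorem IsMatching.eq_zero {d : (⨁ j, W j) →ₗ[R] ⨁ i, V i} {m : ι → κ → Prop}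
    (h : IsMatching d m) (z : ⨁ j, W j) (hz : ∀ j, z j = 0 ∨ ∃ i, m i j) (hd : d z = 0) :
    z = 0 := by
  classical
  refine DFinsupp.ext fun j => ?_
  obtain hj | ⟨i, hij⟩ := hz j
  · exact hj
  have h1 : ∀ j' ∈ z.support, j' ≠ j → d (DirectSum.lof R κ W j' (z j')) i = 0 := by
    intro j' _ hne
    obtain hj' | ⟨i', hij'⟩ := hz j'
    · rw [hj', map_zero, map_zero, DirectSum.zero_apply]
    · have hne' : i ≠ i' := fun he => hne (h.functional (he ▸ hij') hij)
      convert h.off_diagonal hij' hij hne' (z j')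
  have h2 : d z i = ∑ j' ∈ z.support, d (DirectSum.lof R κ W j' (z j')) i := by
    conv_lhs => rw [← DirectSum.sum_support_of z]
    rw [map_sum, DFinsupp.finsetSum_apply]
    rfl
  rw [hd, DirectSum.zero_apply] at h2
  refine (h.bijective hij).1 ?_
  have h3 : d (DirectSum.lof R κ W j (z j)) i = 0 := by
    by_cases hj : j ∈ z.support
    · rw [Finset.sum_eq_single j h1 fun h => (h hj).elim] at h2
      exact h2.symm
    · rw [DFinsupp.notMem_support_iff.1 hj, map_zero, map_zero, DirectSum.zero_apply]
  change d (DirectSum.lof R κ W j (z j)) i = d (DirectSum.lof R κ W j 0) i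
  rw [h3, map_zero, map_zero, DirectSum.zero_apply]

/-- If every summand in the middle is matched on one side or the other, the sequence is exact. -/
theorem IsMatching.exact {μ : Type*} {U : μ → Type*} [∀ i, AddCommGroup (U i)]
    [∀ i, Module R (U i)] {d : (⨁ j, W j) →ₗ[R] ⨁ i, V i} {d' : (⨁ i, V i) →ₗ[R] ⨁ k, U k}
    {m : ι → κ → Prop} {m' : μ → ι → Prop} (h : IsMatching d m) (h' : IsMatching d' m')
    (hdd : d'.comp d = 0) (hc : ∀ i, (∃ j, m i j) ∨ ∃ k, m' k i) (z : ⨁ i, V i) (hz : d' z = 0) :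
    ∃ w, d w = z := by
  obtain ⟨w, hw⟩ := h.exists_agree z
  refine ⟨w, (sub_eq_zero.1 (h'.eq_zero (z - d w) (fun i => ?_) ?_)).symm⟩
  · refine (hc i).imp (fun ⟨j, hj⟩ => ?_) id
    rw [DirectSum.sub_apply, hw i j hj, sub_self]
  · rw [map_sub, hz, zero_sub, neg_eq_zero]
    exact congrArg (fun φ => φ w) hdd

end Matching

/-! ### Chains of pairs and triples -/

section Pairs

variable {X : Type u} [TopologicalSpace X] [CWComplex (Set.univ : Set X)]
  {F : FundamentalGroupoid X ⥤ Type w} {R : Type} [CommRing R]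
  (L : FundamentalGroupoid X ⥤ ModuleCat.{0} R) (A B A' B' : Set (Total F))

open Classical in
/-- The chain `x · c`, with the convention that it is `0` if `c` is not in `(A, B)`. -/
def singleOrZero {q : ℕ} (c : LiftedCell F q) : L.obj (center c.cell) →ₗ[R] Chains L A B q :=
  if h : c.InPair A B then single L A B c h else 0

open Classical in
/-- The map from the chains of `(A, B)` to the chains of `(A', B')` which keeps the cells in
both pairs and kills the others. -/
def transfer (q : ℕ) : Chains L A B q →ₗ[R] Chains L A' B' q :=
  DirectSum.toModule R _ _ fun c => singleOrZero L A' B' c.1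

variable {L A B}

theorem singleOrZero_of_inPair {q : ℕ} {c : LiftedCell F q} (h : c.InPair A B) :
    singleOrZero L A B c = single L A B c h := dif_pos h

theorem singleOrZero_of_not {q : ℕ} {c : LiftedCell F q} (h : ¬ c.InPair A B) :
    singleOrZero L A B c = 0 := dif_neg h

theorem transfer_single {q : ℕ} (c : LiftedCell F q) (h : c.InPair A B)
    (x : L.obj (center c.cell)) :
    transfer L A B A' B' q (single L A B c h x) = singleOrZero L A' B' c x := by
  rw [transfer, single]
  erw [DirectSum.toModule_lof]

theorem faceChain_eq {q m : ℕ} (c : LiftedCell F q) (e' : Cell X m) (h : IsFace c.cell e')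
    (x : L.obj (center c.cell)) : faceChain L A B c e' x =
      singleOrZero L A B (c.face e' h) ((L.map (faceHom c.cell e' h)).hom x) := by
  rw [faceChain, dif_pos h]
  by_cases h' : (c.face e' h).InPair A B
  · rw [dif_pos h', singleOrZero_of_inPair h']
    rfl
  · rw [dif_neg h', singleOrZero_of_not h']
    rfl

theorem faceChain_of_not {q m : ℕ} (c : LiftedCell F q) (e' : Cell X m) (h : ¬ IsFace c.cell e')
    (x : L.obj (center c.cell)) : faceChain L A B c e' x = 0 := by
  rw [faceChain, dif_neg h]
  rfl

variable [RelCWComplex.Finite (Set.univ : Set X)] [T2Space X] [IsRegularCW X] (N : Incidence X)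

theorem boundary_transfer {A B A' B' : Set (Total F)} (hA : A ⊆ A') (hB : B ⊆ B') (q : ℕ) :
    (boundary L A' B' N q).comp (transfer L A B A' B' (q + 1)) =
      (transfer L A B A' B' q).comp (boundary L A B N q) := by
  refine chains_ext _ _ _ fun c hc x => ?_
  rw [LinearMap.comp_apply, LinearMap.comp_apply, transfer_single, boundary_single, map_sum]
  have hterm : ∀ e' : Cell X q, transfer L A B A' B' q (N.num c.cell e' • faceChain L A B c e' x) =
      N.num c.cell e' • faceChain L A' B' c e' x := by
    intro e'
    rw [map_zsmul]
    refine congrArg (N.num c.cell e' • ·) ?_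
    by_cases h : IsFace c.cell e'
    · rw [faceChain_eq c e' h, faceChain_eq c e' h]
      by_cases h1 : (c.face e' h).InPair A B
      · rw [singleOrZero_of_inPair h1, transfer_single]
      · rw [singleOrZero_of_not h1, LinearMap.zero_apply, map_zero, singleOrZero_of_not,
          LinearMap.zero_apply]
        intro h2
        exact h1 ⟨(c.closed_face_subset e' h).trans hc.1, fun h3 => h2.2 (h3.trans hB)⟩
    · rw [faceChain_of_not c e' h, faceChain_of_not c e' h, map_zero]
  rw [Finset.sum_congr rfl fun e' _ => hterm e']
  by_cases h1 : c.InPair A' B'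
  · rw [singleOrZero_of_inPair h1, boundary_single]
  · rw [singleOrZero_of_not h1, LinearMap.zero_apply, map_zero]
    have hcB : c.closed ⊆ B' := by
      by_contra h2
      exact h1 ⟨hc.1.trans hA, h2⟩
    refine (Finset.sum_eq_zero fun e' _ => ?_).symm
    by_cases h : IsFace c.cell e'
    · rw [faceChain_eq c e' h, singleOrZero_of_not fun h2 =>
        h2.2 ((c.closed_face_subset e' h).trans hcB), LinearMap.zero_apply, smul_zero]
    · rw [faceChain_of_not c e' h, smul_zero]

theorem chainComplex_d (q : ℕ) :
    (chainComplex L A B N).d (q + 1) q = ModuleCat.ofHom (boundary L A B N q) :=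
  ChainComplex.of_d (fun q => ModuleCat.of R (Chains L A B q))
    (fun q => ModuleCat.ofHom (boundary L A B N q)) q

variable (L) in
/-- The chain map induced by an inclusion of pairs. -/
def pairMap {A B A' B' : Set (Total F)} (hA : A ⊆ A') (hB : B ⊆ B') :
    chainComplex L A B N ⟶ chainComplex L A' B' N :=
  ChainComplex.ofHom (fun q => ModuleCat.ofHom (transfer L A B A' B' q)) fun q => by
    rw [chainComplex_d, chainComplex_d]
    refine (ModuleCat.ofHom_comp _ _).symm.trans (Eq.trans ?_ (ModuleCat.ofHom_comp _ _))
    rw [boundary_transfer N hA hB]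

variable (L) in
/-- The short exact sequence of chain complexes of the triple `U ⊆ V ⊆ W`. -/
def tripleSequence {U V W : Set (Total F)} (hUV : U ⊆ V) (hVW : V ⊆ W) :
    ShortComplex (ChainComplex (ModuleCat.{max u w} R) ℕ) :=
  ShortComplex.mk (pairMap L N hVW (subset_refl U)) (pairMap L N (subset_refl W) hUV) <| by
    refine HomologicalComplex.hom_ext _ _ fun q => ?_
    refine ModuleCat.hom_ext (chains_ext _ _ _ fun c hc x => ?_)
    have h1 : c.InPair W U := ⟨hc.1.trans hVW, hc.2⟩
    change transfer L W U W V q (transfer L V U W U q (single L V U c hc x)) = 0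
    rw [transfer_single, singleOrZero_of_inPair h1,
      transfer_single, singleOrZero_of_not fun h => h.2 hc.1]
    rfl

theorem tripleSequence_shortExact {U V W : Set (Total F)} (hUV : U ⊆ V) (hVW : V ⊆ W) :
    (tripleSequence L N hUV hVW).ShortExact := by
  refine HomologicalComplex.shortExact_of_degreewise_shortExact _ fun q => ?_
  refine ShortComplex.Splitting.shortExact
    { r := ModuleCat.ofHom (transfer L W U V U q)
      s := ModuleCat.ofHom (transfer L W V W U q)
      f_r := ?_
      s_g := ?_
      id := ?_ }
  · refine ModuleCat.hom_ext (chains_ext _ _ _ fun c hc x => ?_)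
    have h1 : c.InPair W U := ⟨hc.1.trans hVW, hc.2⟩
    change transfer L W U V U q (transfer L V U W U q (single L V U c hc x)) = single L V U c hc x
    rw [transfer_single, singleOrZero_of_inPair h1,
      transfer_single, singleOrZero_of_inPair hc]
  · refine ModuleCat.hom_ext (chains_ext _ _ _ fun c hc x => ?_)
    have h1 : c.InPair W U := ⟨hc.1, fun h => hc.2 (h.trans hUV)⟩
    change transfer L W U W V q (transfer L W V W U q (single L W V c hc x)) = single L W V c hc x
    rw [transfer_single, singleOrZero_of_inPair h1, transfer_single, singleOrZero_of_inPair hc]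
  · refine ModuleCat.hom_ext (chains_ext _ _ _ fun c hc x => ?_)
    change transfer L V U W U q (transfer L W U V U q (single L W U c hc x)) +
      transfer L W V W U q (transfer L W U W V q (single L W U c hc x)) = single L W U c hc x
    rw [transfer_single, transfer_single]
    by_cases h : c.closed ⊆ V
    · have h1 : c.InPair V U := ⟨h, hc.2⟩
      rw [singleOrZero_of_inPair h1, transfer_single,
        singleOrZero_of_inPair hc, singleOrZero_of_not fun h' => h'.2 h, LinearMap.zero_apply,
        map_zero, add_zero]
    · have h1 : c.InPair W V := ⟨hc.1, h⟩
      rw [singleOrZero_of_not (A := V) (B := U) fun h' => h h'.1, LinearMap.zero_apply, map_zero,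
        zero_add, singleOrZero_of_inPair h1, transfer_single,
        singleOrZero_of_inPair hc]

end Pairs

open HomologicalComplex in
/-- A chain map which is onto with acyclic kernel is a quasi-isomorphism. -/
theorem quasiIso_of_shortExact {C ι : Type*} [Category* C] [Abelian C] {c : ComplexShape ι}
    {S : ShortComplex (HomologicalComplex C c)} (hS : S.ShortExact) (h : S.X₁.Acyclic) :
    QuasiIso S.g := by
  rw [quasiIso_iff]
  intro i
  rw [quasiIsoAt_iff_isIso_homologyMap]
  have hz : ∀ j, Limits.IsZero (S.X₁.homology j) := fun j => (h j).isZero_homology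
  have hm : Mono (homologyMap S.g i) := (hS.homology_exact₂ i).mono_g ((hz i).eq_of_src _ _)
  have he : Epi (homologyMap S.g i) := by
    by_cases! hi : ∃ j, c.Rel i j
    · obtain ⟨j, hij⟩ := hi
      exact (hS.homology_exact₃ i j hij).epi_f ((hz j).eq_of_tgt _ _)
    · have := hS.epi_g
      exact epi_homologyMap_of_epi_of_not_rel S.g i hi
  exact isIso_of_mono_of_epi _

/-! ### Coefficients of boundaries -/

section BoundaryCoefficients

variable {X : Type u} [TopologicalSpace X] [CWComplex (Set.univ : Set X)]
  {F : FundamentalGroupoid X ⥤ Type w} {R : Type} [CommRing R]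
  (L : FundamentalGroupoid X ⥤ ModuleCat.{0} R) (A B : Set (Total F))

theorem single_apply_same {q : ℕ} (c : LiftedCell F q) (h : c.InPair A B)
    (x : L.obj (center c.cell)) : (single L A B c h x) ⟨c, h⟩ = x := by
  classical
  rw [single]
  exact DirectSum.of_eq_same (β := fun c : {c : LiftedCell F q // c.InPair A B} =>
    L.obj (center c.1.cell)) ⟨c, h⟩ x

theorem single_apply_of_ne {q : ℕ} (c : LiftedCell F q) (h : c.InPair A B)
    (x : L.obj (center c.cell)) (c' : {c : LiftedCell F q // c.InPair A B}) (hne : c'.1 ≠ c) :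
    (single L A B c h x) c' = 0 := by
  classical
  rw [single]
  exact DirectSum.of_eq_of_ne (β := fun c : {c : LiftedCell F q // c.InPair A B} =>
    L.obj (center c.1.cell)) _ _ _ fun h => hne (congrArg Subtype.val h)

theorem single_eq_lof {q : ℕ} [DecidableEq {c : LiftedCell F q // c.InPair A B}]
    (c : {c : LiftedCell F q // c.InPair A B}) (x : L.obj (center c.1.cell)) :
    single L A B c.1 c.2 x = DirectSum.lof R {c : LiftedCell F q // c.InPair A B}
      (fun c => L.obj (center c.1.cell)) c x := by
  rw [single]
  convert! rfl

theorem singleOrZero_apply_of_ne {q : ℕ} (c : LiftedCell F q)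
    (x : L.obj (center c.cell)) (c' : {c : LiftedCell F q // c.InPair A B}) (hne : c'.1 ≠ c) :
    (singleOrZero L A B c x) c' = 0 := by
  by_cases h : c.InPair A B
  · rw [singleOrZero_of_inPair h, single_apply_of_ne L A B c h x c' hne]
  · rw [singleOrZero_of_not h]
    rfl

variable [RelCWComplex.Finite (Set.univ : Set X)] (N : Incidence X)

theorem boundary_single_apply_face {q : ℕ} (c : LiftedCell F (q + 1)) (hc : c.InPair A B)
    (x : L.obj (center c.cell)) (e : Cell X q) (h : IsFace c.cell e)
    (hf : (c.face e h).InPair A B) :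
    (boundary L A B N q (single L A B c hc x)) ⟨c.face e h, hf⟩ =
      N.num c.cell e • (L.map (faceHom c.cell e h)).hom x := by
  rw [boundary_single, DFinsupp.finsetSum_apply, Finset.sum_eq_single e]
  · rw [faceChain_eq c e h, singleOrZero_of_inPair hf]
    refine (DFinsupp.smul_apply _ _ _).trans (congrArg (N.num c.cell e • ·) ?_)
    exact single_apply_same L A B _ hf _
  · intro e' _ hne
    refine (DFinsupp.smul_apply _ _ _).trans ?_
    by_cases h' : IsFace c.cell e'
    · rw [faceChain_eq c e' h', singleOrZero_apply_of_ne L A B _ _ _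
        fun he => hne (congrArg LiftedCell.cell he).symm, smul_zero]
    · rw [faceChain_of_not c e' h']
      exact smul_zero _
  · exact fun h => (h (Finset.mem_univ e)).elim

theorem boundary_single_apply_of_not_face {q : ℕ} (c : LiftedCell F (q + 1)) (hc : c.InPair A B)
    (x : L.obj (center c.cell)) (c' : {c : LiftedCell F q // c.InPair A B})
    (h : ¬ ∃ h : IsFace c.cell c'.1.cell, c.face c'.1.cell h = c'.1) :
    (boundary L A B N q (single L A B c hc x)) c' = 0 := by
  obtain ⟨c', hc'⟩ := c'
  rw [boundary_single, DFinsupp.finsetSum_apply]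
  refine Finset.sum_eq_zero fun e' _ => (DFinsupp.smul_apply _ _ _).trans ?_
  by_cases h' : IsFace c.cell e'
  · rw [faceChain_eq c e' h', singleOrZero_apply_of_ne, smul_zero]
    intro he
    change c' = _ at he
    subst he
    exact h ⟨h', rfl⟩
  · rw [faceChain_of_not c e' h']
    exact smul_zero _

theorem boundary_single_apply_bijective {q : ℕ} (c : LiftedCell F (q + 1)) (hc : c.InPair A B)
    (c' : {c : LiftedCell F q // c.InPair A B})
    (h : ∃ h : IsFace c.cell c'.1.cell, c.face c'.1.cell h = c'.1) :
    Function.Bijective fun x => (boundary L A B N q (single L A B c hc x)) c' := by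
  obtain ⟨⟨e, p⟩, hf⟩ := c'
  change ∃ h : IsFace c.cell e, c.face e h = ⟨e, p⟩ at h
  obtain ⟨h, he⟩ := h
  have hp : F.map (faceHom c.cell e h) c.pt = p := eq_of_heq (LiftedCell.mk.inj he).2
  revert hf
  subst hp
  intro hf
  have hb : Function.Bijective (L.map (faceHom c.cell e h)).hom :=
    ConcreteCategory.bijective_of_isIso (L.map (faceHom c.cell e h))
  have hs : Function.Bijective fun y : L.obj (center e) => N.num c.cell e • y := by
    obtain hn | hn := N.num_of_face _ _ h <;> rw [hn]
    · simp only [one_smul]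
      exact Function.bijective_id
    · simp only [neg_smul, one_smul]
      exact (Equiv.neg _).bijective
  have := hs.comp hb
  convert! this using 2 with x
  exact boundary_single_apply_face L A B N c hc x e h hf

end BoundaryCoefficients

/-! ### The collar -/

section CollarCells

variable {X : Type u} [TopologicalSpace X] {s : ℕ} {f : Fin s → C(X, UnitAddCircle)}

variable [CWComplex (Set.univ : Set X)] [IsRegularCW X]

/-- `N̄₀⁺` is a subcomplex. -/
theorem LiftedCell.image_closed_subset_upperBoundary
    (hN : ∀ (i : Fin s) (q : ℕ) (e : Cell X q), (openCell e ∩ f i ⁻¹' {0}).Nonempty →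
      openCell e ⊆ f i ⁻¹' {0})
    {q : ℕ} {c : LiftedCell (barFunctor f) q} {z : Total (barFunctor f)} (hz : z ∈ c.opened)
    (h : toBar f z ∈ upperBoundary f) : toBar f '' c.closed ⊆ upperBoundary f := by
  obtain ⟨hd, i, hi⟩ := h
  rintro _ ⟨z', hz', rfl⟩
  constructor
  · intro j
    obtain hj | ⟨hj, hj'⟩ := c.height_dichotomy hN j
    · rw [hj z' hz', ← hj z hz.1]
      exact hd j
    · have h1 := hj' z hz
      have h2 := hd j
      have h3 := hj z' hz'
      have h4 : ⌊c.pt.1 j⌋ < 1 := by exact_mod_cast h1.1.trans_le h2.2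
      have h5 : -1 < ⌊c.pt.1 j⌋ := by
        have : (-1 : ℝ) < ⌊c.pt.1 j⌋ := by linarith
        exact_mod_cast this
      have h6 : ⌊c.pt.1 j⌋ = 0 := by omega
      rw [h6] at h3
      simpa using h3
  · refine ⟨i, ?_⟩
    obtain hj | ⟨-, hj⟩ := c.height_dichotomy hN i
    · rw [hj z' hz', ← hj z hz.1, hi]
    · have h1 := hj z hz
      rw [hi] at h1
      have h2 : ⌊c.pt.1 i⌋ < 1 := by exact_mod_cast h1.1
      have h3 : 1 < ⌊c.pt.1 i⌋ + 1 := by exact_mod_cast h1.2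
      omega

namespace Collar

variable (κ : Collar f)

omit [IsRegularCW X] in
theorem upperBoundary_subset_carrier : upperBoundary f ⊆ κ.carrier := fun z hz =>
  ⟨(⟨z, hz⟩, ⟨0, le_rfl, κ.ε_pos.le⟩), κ.map_zero ⟨z, hz⟩⟩

omit [IsRegularCW X] in
theorem carrier_subset_domain : κ.carrier ⊆ domain f := by
  rintro _ ⟨p, rfl⟩
  exact κ.map_mem p

/-- The image in the collar of the cylinder over a subset of `N̄₀⁺`, with heights in `T`. -/
def cyl (S : Set (Bar f)) (T : Set ℝ) : Set (Bar f) := κ.map '' {p | p.1.1 ∈ S ∧ p.2.1 ∈ T}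

/-- The cell `i` is the push `e × ε` of a cell `e` of `N̄₀⁺`, and `j` is the cylinder
`e × (0, ε)`. -/
def Matched {q : ℕ} (i : LiftedCell (barFunctor f) q) (j : LiftedCell (barFunctor f) (q + 1)) :
    Prop :=
  ∃ e : LiftedCell (barFunctor f) q, toBar f '' e.opened ⊆ upperBoundary f ∧
    toBar f '' i.opened = κ.cyl (toBar f '' e.opened) {κ.ε} ∧
    toBar f '' j.opened = κ.cyl (toBar f '' e.opened) (Set.Ioo 0 κ.ε)

variable {κ}

omit [IsRegularCW X] in
theorem mem_cyl {p} {S : Set (Bar f)} {T : Set ℝ} :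
    κ.map p ∈ κ.cyl S T ↔ p.1.1 ∈ S ∧ p.2.1 ∈ T := by
  constructor
  · rintro ⟨p', hp', h⟩
    rwa [κ.isEmbedding.injective h] at hp'
  · exact fun h => ⟨p, h, rfl⟩

omit [IsRegularCW X] in
theorem cyl_subset_carrier (S : Set (Bar f)) (T : Set ℝ) : κ.cyl S T ⊆ κ.carrier :=
  Set.image_subset_range _ _

omit [IsRegularCW X] in
theorem cyl_disjoint_upperBoundary {S : Set (Bar f)} {T : Set ℝ} (hT : (0 : ℝ) ∉ T) :
    Disjoint (κ.cyl S T) (upperBoundary f) := by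
  refine Set.disjoint_left.2 ?_
  rintro _ ⟨p, ⟨-, hp⟩, rfl⟩ h
  have h1 := κ.isEmbedding.injective (κ.map_zero ⟨_, h⟩)
  rw [← h1] at hp
  exact hT hp

omit [IsRegularCW X] in
/-- Distinct cells of `N̄₀⁺` have disjoint cylinders over them. -/
theorem eq_of_mem_cyl {q m : ℕ} {e : LiftedCell (barFunctor f) q}
    {e' : LiftedCell (barFunctor f) m} {z : Bar f} {T T' : Set ℝ}
    (h : z ∈ κ.cyl (toBar f '' e.opened) T) (h' : z ∈ κ.cyl (toBar f '' e'.opened) T') :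
    (⟨q, e⟩ : Σ n, LiftedCell (barFunctor f) n) = ⟨m, e'⟩ := by
  obtain ⟨p, ⟨⟨y, hy, hyp⟩, -⟩, rfl⟩ := h
  obtain ⟨⟨y', hy', hyp'⟩, -⟩ := mem_cyl.1 h'
  obtain rfl := LiftedCell.toBar_injective (hyp.trans hyp'.symm)
  exact LiftedCell.eq_of_mem_opened hy hy'

omit [IsRegularCW X] in
theorem eq_of_mem_image_opened {q m : ℕ} {c : LiftedCell (barFunctor f) q}
    {c' : LiftedCell (barFunctor f) m} {z : Bar f} (h : z ∈ toBar f '' c.opened)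
    (h' : z ∈ toBar f '' c'.opened) :
    (⟨q, c⟩ : Σ n, LiftedCell (barFunctor f) n) = ⟨m, c'⟩ := by
  obtain ⟨y, hy, rfl⟩ := h
  obtain ⟨y', hy', hyy⟩ := h'
  obtain rfl := LiftedCell.toBar_injective hyy
  exact LiftedCell.eq_of_mem_opened hy hy'

theorem image_opened_nonempty {q : ℕ} (c : LiftedCell (barFunctor f) q) :
    (toBar f '' c.opened).Nonempty := ⟨_, _, c.center_mem_opened, rfl⟩

variable [T2Space X]

/-- The cylinder over a closed cell of `N̄₀⁺` is closed. -/
theorem isClosed_cyl {q : ℕ} (e : LiftedCell (barFunctor f) q)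
    (he : toBar f '' e.closed ⊆ upperBoundary f) :
    IsClosed (κ.cyl (toBar f '' e.closed) Set.univ) := by
  have h1 : IsCompact {z : upperBoundary f | z.1 ∈ toBar f '' e.closed} := by
    rw [Subtype.isCompact_iff]
    convert e.isCompact_toBar_image_closed using 1
    ext z
    exact ⟨fun ⟨y, hy, h⟩ => h ▸ hy, fun h => ⟨⟨z, he h⟩, h, rfl⟩⟩
  have h2 := (h1.prod (isCompact_univ (X := Set.Icc (0 : ℝ) κ.ε))).image κ.isEmbedding.continuous
  convert h2.isClosed using 1
  exact congrArg (κ.map '' ·) (by ext p; simp)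

variable (hN : ∀ (i : Fin s) (q : ℕ) (e : Cell X q), (openCell e ∩ f i ⁻¹' {0}).Nonempty →
  openCell e ⊆ f i ⁻¹' {0})
include hN

/-- The closure of a cell of the collar above the cell `e` of `N̄₀⁺` lies in the closed
cylinder over the closure of `e`. -/
theorem image_closed_subset_cyl {q m : ℕ} {e : LiftedCell (barFunctor f) q}
    (he : toBar f '' e.opened ⊆ upperBoundary f) {c : LiftedCell (barFunctor f) m} {T : Set ℝ}
    (hc : toBar f '' c.opened = κ.cyl (toBar f '' e.opened) T) :
    toBar f '' c.closed ⊆ κ.cyl (toBar f '' e.closed) Set.univ := by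
  have h := LiftedCell.image_closed_subset_upperBoundary hN e.center_mem_opened
    (he ⟨_, e.center_mem_opened, rfl⟩)
  rw [c.toBar_image_closed_eq_closure, (isClosed_cyl e h).closure_subset_iff, hc]
  rintro _ ⟨p, ⟨hp, -⟩, rfl⟩
  exact mem_cyl.2 ⟨Set.image_mono e.opened_subset_closed hp, Set.mem_univ _⟩

theorem inPair_of_image_opened {q m : ℕ} {e : LiftedCell (barFunctor f) q}
    (he : toBar f '' e.opened ⊆ upperBoundary f) {c : LiftedCell (barFunctor f) m} {T : Set ℝ}
    (hT : (0 : ℝ) ∉ T) (hc : toBar f '' c.opened = κ.cyl (toBar f '' e.opened) T) :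
    c.InPair (toBar f ⁻¹' κ.carrier) (toBar f ⁻¹' upperBoundary f) := by
  refine ⟨fun z hz => cyl_subset_carrier _ _ (image_closed_subset_cyl hN he hc ⟨z, hz, rfl⟩),
    fun h => ?_⟩
  have h1 := c.center_mem_opened
  refine Set.disjoint_left.1 (cyl_disjoint_upperBoundary (κ := κ)
    (S := toBar f '' e.opened) hT) ?_ (h h1.1)
  rw [← hc]
  exact ⟨_, h1, rfl⟩

theorem Matched.inPair_left {q : ℕ} {i : LiftedCell (barFunctor f) q} {j}
    (h : κ.Matched i j) : i.InPair (toBar f ⁻¹' κ.carrier) (toBar f ⁻¹' upperBoundary f) := by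
  obtain ⟨e, he, hi, -⟩ := h
  exact inPair_of_image_opened hN he (T := {κ.ε}) (fun h => κ.ε_pos.ne h) hi

theorem Matched.inPair_right {q : ℕ} {i : LiftedCell (barFunctor f) q} {j}
    (h : κ.Matched i j) : j.InPair (toBar f ⁻¹' κ.carrier) (toBar f ⁻¹' upperBoundary f) := by
  obtain ⟨e, he, -, hj⟩ := h
  exact inPair_of_image_opened hN he (T := Set.Ioo 0 κ.ε) (fun h => h.1.ne rfl) hj

omit [T2Space X] in
/-- Every cell of the collar outside `N̄₀⁺` is matched. -/
theorem exists_matched {q : ℕ} (c : LiftedCell (barFunctor f) q)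
    (hc : c.InPair (toBar f ⁻¹' κ.carrier) (toBar f ⁻¹' upperBoundary f)) :
    ∃ (m : ℕ) (i : LiftedCell (barFunctor f) m) (j : LiftedCell (barFunctor f) (m + 1)),
      κ.Matched i j ∧ ((⟨q, c⟩ : Σ n, LiftedCell (barFunctor f) n) = ⟨m, i⟩ ∨
        (⟨q, c⟩ : Σ n, LiftedCell (barFunctor f) n) = ⟨m + 1, j⟩) := by
  have hz := c.center_mem_opened
  obtain ⟨⟨⟨y, hy⟩, ⟨t, ht0, htε⟩⟩, hyt⟩ := hc.1 hz.1
  obtain ⟨m, e, he⟩ := LiftedCell.exists_mem_opened (F := barFunctor f) ⟨⟨y.proj⟩, y.1.2, y.2⟩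
  have hye : y ∈ toBar f '' e.opened := ⟨_, he, rfl⟩
  have he' : toBar f '' e.opened ⊆ upperBoundary f :=
    (Set.image_mono e.opened_subset_closed).trans
      (LiftedCell.image_closed_subset_upperBoundary hN he hy)
  obtain ⟨i, hi⟩ := κ.top m e he'
  obtain ⟨j, hj⟩ := κ.cylinder m e he'
  refine ⟨m, i, j, ⟨e, he', hi, hj⟩, ?_⟩
  have h0 : t ≠ 0 := by
    rintro rfl
    rw [show κ.map _ = _ from κ.map_zero ⟨y, hy⟩] at hyt
    refine hc.2 (Set.image_subset_iff.1
      (LiftedCell.image_closed_subset_upperBoundary hN hz ?_))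
    rw [← hyt]
    exact hy
  have h1 : toBar f ⟨center c.cell, c.pt⟩ ∈ toBar f '' c.opened := ⟨_, hz, rfl⟩
  by_cases htε' : t = κ.ε
  · refine Or.inl (eq_of_mem_image_opened h1 ?_)
    rw [hi, ← hyt]
    exact ⟨_, ⟨hye, htε'⟩, rfl⟩
  · refine Or.inr (eq_of_mem_image_opened h1 ?_)
    rw [hj, ← hyt]
    exact ⟨_, ⟨hye, lt_of_le_of_ne ht0 h0.symm, lt_of_le_of_ne htε htε'⟩, rfl⟩

omit hN [T2Space X] in
theorem Matched.right_unique {q : ℕ} {i : LiftedCell (barFunctor f) q} {j j'}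
    (h : κ.Matched i j) (h' : κ.Matched i j') : j = j' := by
  obtain ⟨e, -, hi, hj⟩ := h
  obtain ⟨e', -, hi', hj'⟩ := h'
  obtain ⟨z, hz⟩ := image_opened_nonempty i
  obtain rfl := eq_of_heq (Sigma.mk.inj (eq_of_mem_cyl (hi ▸ hz) (hi' ▸ hz))).2
  obtain ⟨z, hz⟩ := image_opened_nonempty j
  exact eq_of_heq (Sigma.mk.inj (eq_of_mem_image_opened hz (hj' ▸ hj ▸ hz))).2

omit hN in
/-- The top of a cylinder is a face of it. -/
theorem Matched.exists_face_eq {q : ℕ} {i : LiftedCell (barFunctor f) q} {j}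
    (h : κ.Matched i j) : ∃ h : IsFace j.cell i.cell, j.face i.cell h = i := by
  obtain ⟨e, -, hi, hj⟩ := h
  have hz := i.center_mem_opened
  refine LiftedCell.exists_face_eq hz ?_
  have h1 : toBar f ⟨center i.cell, i.pt⟩ ∈ toBar f '' j.closed := by
    have h2 : toBar f ⟨center i.cell, i.pt⟩ ∈ toBar f '' i.opened := ⟨_, hz, rfl⟩
    rw [hi] at h2
    obtain ⟨⟨y, t⟩, ⟨hy, ht⟩, hyt⟩ := h2
    rw [← hyt, j.toBar_image_closed_eq_closure, hj]
    have h3 : Continuous fun r : Set.Icc (0 : ℝ) κ.ε => κ.map (y, r) :=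
      κ.isEmbedding.continuous.comp (by fun_prop)
    refine map_mem_closure h3 (s := Subtype.val ⁻¹' Set.Ioo 0 κ.ε) ?_ fun r hr =>
      mem_cyl.2 ⟨hy, hr⟩
    refine closure_subtype.2 ?_
    rw [Subtype.image_preimage_coe, Set.inter_eq_right.2 Set.Ioo_subset_Icc_self,
      closure_Ioo κ.ε_pos.ne]
    exact t.2
  obtain ⟨z, hz', h4⟩ := h1
  rwa [LiftedCell.toBar_injective h4] at hz'

/-- No other push of a cell of the same dimension is a face of a cylinder. -/
theorem Matched.eq_of_face {q : ℕ} {i i' : LiftedCell (barFunctor f) q} {j j'}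
    (h : κ.Matched i j) (h' : κ.Matched i' j')
    (hf : ∃ h : IsFace j.cell i'.cell, j.face i'.cell h = i') : i' = i := by
  obtain ⟨e, he, hi, hj⟩ := h
  obtain ⟨e', he', hi', hj'⟩ := h'
  obtain ⟨hf, hf'⟩ := hf
  obtain ⟨z, hz⟩ := image_opened_nonempty i'
  have h1 : z ∈ toBar f '' j.closed := by
    refine Set.image_mono ((Eq.subset ?_).trans (j.closed_face_subset i'.cell hf))
      (Set.image_mono i'.opened_subset_closed hz)
    rw [hf']
  have h2 := image_closed_subset_cyl hN he hj h1
  have h3 : z ∈ κ.cyl (toBar f '' e'.opened) {κ.ε} := hi' ▸ hz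
  obtain ⟨p, ⟨⟨y, hy, hyp⟩, -⟩, rfl⟩ := h3
  obtain ⟨⟨y', hy', hyp'⟩, -⟩ := mem_cyl.1 h2
  obtain rfl := LiftedCell.toBar_injective (hyp.trans hyp'.symm)
  obtain rfl := LiftedCell.eq_of_mem_closed hy' hy
  exact eq_of_heq (Sigma.mk.inj (eq_of_mem_image_opened hz (hi ▸ hi' ▸ hz))).2

variable [RelCWComplex.Finite (Set.univ : Set X)] (N : Incidence X)
  {R : Type} [CommRing R] (L : FundamentalGroupoid X ⥤ ModuleCat.{0} R)

theorem isMatching_boundary (κ : Collar f) (q : ℕ) :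
    IsMatching (boundary (F := barFunctor f) L (toBar f ⁻¹' κ.carrier)
      (toBar f ⁻¹' upperBoundary f) N q) fun i j => κ.Matched i.1 j.1 where
  functional h h' := Subtype.ext (h.right_unique h')
  bijective {i j} h := by
    simp only [← single_eq_lof]
    exact boundary_single_apply_bijective L _ _ N j.1 j.2 i h.exists_face_eq
  off_diagonal {i i' j j'} h h' hne x := by
    rw [← single_eq_lof]
    exact boundary_single_apply_of_not_face L _ _ N j.1 j.2 x i' fun hf =>
      hne (Subtype.ext (Matched.eq_of_face hN h h' hf))

/-- The collar has no homology relative to `N̄₀⁺`. -/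
theorem acyclic (κ : Collar f) :
    (chainComplex (F := barFunctor f) L (toBar f ⁻¹' κ.carrier) (toBar f ⁻¹' upperBoundary f)
      N).Acyclic := by
  rintro (_ | q)
  · rw [HomologicalComplex.exactAt_iff' _ 1 0 0 (by simp) (by simp),
      ShortComplex.moduleCat_exact_iff]
    intro z _
    obtain ⟨w, hw⟩ := (isMatching_boundary hN N L κ 0).exists_agree z
    refine ⟨w, Eq.trans (congrArg (fun φ => φ.hom w) (chainComplex_d N 0)) ?_⟩
    refine DFinsupp.ext fun c => ?_
    obtain ⟨m, i, j, hij, h | h⟩ := exists_matched hN c.1 c.2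
    · obtain ⟨rfl, h⟩ := Sigma.mk.inj h
      exact hw c ⟨j, hij.inPair_right hN⟩ (eq_of_heq h ▸ hij)
    · exact absurd (Sigma.mk.inj h).1 (Nat.succ_ne_zero m).symm
  · rw [HomologicalComplex.exactAt_iff' _ (q + 2) (q + 1) q (by simp) (by simp),
      ShortComplex.moduleCat_exact_iff]
    intro z hz
    obtain ⟨w, hw⟩ := (isMatching_boundary hN N L κ (q + 1)).exact (isMatching_boundary hN N L κ q)
      (boundary_boundary _ _ _ N q) (fun c => by
        obtain ⟨m, i, j, hij, h | h⟩ := exists_matched hN c.1 c.2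
        · obtain ⟨rfl, h⟩ := Sigma.mk.inj h
          exact Or.inl ⟨⟨j, hij.inPair_right hN⟩, eq_of_heq h ▸ hij⟩
        · obtain ⟨h0, h⟩ := Sigma.mk.inj h
          obtain rfl := Nat.succ.inj h0
          exact Or.inr ⟨⟨i, hij.inPair_left hN⟩, eq_of_heq h ▸ hij⟩) z
      ((congrArg (fun φ => φ.hom z) (chainComplex_d N q)).symm.trans hz)
    exact ⟨w, Eq.trans (congrArg (fun φ => φ.hom w) (chainComplex_d N (q + 1))) hw⟩

/-- The relative homology of the fundamental domain modulo the collar is the one modulo `N̄₀⁺`. -/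
theorem nonempty_homology_iso (κ : Collar f) (q : ℕ) :
    Nonempty ((barComplex f N L (domain f) (upperBoundary f)).homology q ≅
      (barComplex f N L (domain f) κ.carrier).homology q) := by
  have hUV := Set.preimage_mono (f := toBar f) κ.upperBoundary_subset_carrier
  have hVW := Set.preimage_mono (f := toBar f) κ.carrier_subset_domain
  have := quasiIso_of_shortExact (tripleSequence_shortExact (L := L) N hUV hVW)
    (acyclic hN N L κ)
  exact ⟨isoOfQuasiIsoAt (tripleSequence L N hUV hVW).g q⟩

end Collar

end CollarCells

/-! ### Extension of scalars -/

section ExtendScalars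

open scoped ChangeOfRings

universe v

variable {R S : Type} [CommRing R] [CommRing S] (φ : R →+* S)

/-- The canonical map `m ↦ 1 ⊗ m` from a module to its extension of scalars. -/
def extIncl (M : ModuleCat.{v} R) : M →ₛₗ[φ] (ModuleCat.extendScalars φ).obj M where
  toFun m := (1 : S) ⊗ₜ[R,φ] m
  map_add' m m' := TensorProduct.tmul_add _ _ _
  map_smul' r m := by
    let _ := φ.toAlgebra
    have h : (1 : S) ⊗ₜ[R] (r • m) = φ r • ((1 : S) ⊗ₜ[R] m) := by
      rw [TensorProduct.tmul_smul, ← algebraMap_smul S r]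
      rfl
    exact h

/-- The linear map on an extension of scalars induced by a semilinear map. The target may live in
any universe. -/
def extLift (M : ModuleCat.{v} R) {N : Type w} [AddCommGroup N] [Module S N] (g : M →ₛₗ[φ] N) :
    (ModuleCat.extendScalars φ).obj M →ₗ[S] N :=
  letI := φ.toAlgebra
  letI : Module R N := Module.compHom N φ
  haveI : IsScalarTower R S N := ⟨fun r s n => mul_smul (φ r) s n⟩
  letI g' : M →ₗ[R] N :=
    { toFun := g, map_add' := g.map_add, map_smul' := fun r m => g.map_smulₛₗ r m }
  show S ⊗[R] M →ₗ[S] N from g'.liftBaseChange S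

theorem extLift_incl (M : ModuleCat.{v} R) {N : Type w} [AddCommGroup N] [Module S N]
    (g : M →ₛₗ[φ] N) (m : M) : extLift φ M g (extIncl φ M m) = g m :=
  one_smul S (g m)

theorem extendScalars_hom_ext {M : ModuleCat.{v} R} {N : Type w} [AddCommGroup N] [Module S N]
    {α β : (ModuleCat.extendScalars φ).obj M →ₗ[S] N}
    (h : ∀ m, α (extIncl φ M m) = β (extIncl φ M m)) : α = β := by
  refine LinearMap.ext fun z => ?_
  induction z using TensorProduct.induction_on with
  | zero => exact (map_zero α).trans (map_zero β).symm
  | tmul s m =>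
    have h1 : (s ⊗ₜ[R,φ] m : (ModuleCat.extendScalars φ).obj M) = (show S from s) • extIncl φ M m :=
      congrArg (fun s : S => s ⊗ₜ[R,φ] m) (mul_one (show S from s)).symm
    refine (congrArg α h1).trans (Eq.trans ?_ (congrArg β h1).symm)
    rw [map_smul, map_smul, h m]
  | add x y hx hy =>
    exact (map_add α x y).trans ((congrArg₂ (· + ·) hx hy).trans (map_add β x y).symm)

end ExtendScalars

/-! ### Generators of the complex `D_*` -/

section BalancedLift

variable {S : Type} [CommRing S] {Γ : Type u} [Monoid Γ] {M : Type} [AddCommGroup M] [Module S M]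
  (ρ : Representation S Γᵐᵒᵖ M) {C : Type u} [AddCommGroup C] (τ : Representation ℤ Γ C)
  {Q : Type*} [AddCommGroup Q] [Module S Q]

/-- The class of `m ⊗ c` in the balanced tensor product. -/
def balancedMk (m : M) (c : C) : BalancedTensor ρ τ := (balancedRel ρ τ).mkQ (m ⊗ₜ[ℤ] c)

theorem balancedMk_act (g : Γ) (m : M) (c : C) :
    balancedMk ρ τ (ρ (MulOpposite.op g) m) c = balancedMk ρ τ m (τ g c) := by
  refine (Submodule.Quotient.eq _).2 (Submodule.subset_span ⟨g, m, c, rfl⟩)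

/-- The linear map on a balanced tensor product induced by a balanced biadditive map. -/
def balancedLift (β : M →+ C →+ Q) (hs : ∀ (a : S) m c, β (a • m) c = a • β m c)
    (hβ : ∀ g m c, β (ρ (MulOpposite.op g) m) c = β m (τ g c)) : BalancedTensor ρ τ →ₗ[S] Q :=
  let β' : M ⊗[ℤ] C →ₗ[S] Q :=
    { toFun := TensorProduct.liftAddHom β fun n m c => by
        rw [map_zsmul, map_zsmul, AddMonoidHom.zsmul_apply]
      map_add' := map_add _
      map_smul' := fun a x => by
        induction x using TensorProduct.induction_on with
        | zero => rw [smul_zero, map_zero, smul_zero]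
        | tmul m c => exact hs a m c
        | add x y hx hy => rw [smul_add, map_add, map_add, hx, hy, smul_add] }
  Submodule.liftQ _ β' <| by
    rw [balancedRel, Submodule.span_le]
    rintro _ ⟨g, m, c, rfl⟩
    refine (map_sub β' _ _).trans (sub_eq_zero.2 ?_)
    exact hβ g m c

/-- The class of `m ⊗ c`, as an additive function of `c`. -/
def balancedMkHom (m : M) : C →+ BalancedTensor ρ τ where
  toFun := balancedMk ρ τ m
  map_zero' := by rw [balancedMk, TensorProduct.tmul_zero, map_zero]
  map_add' c c' := by
    rw [balancedMk, TensorProduct.tmul_add, map_add]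
    rfl

theorem balancedMk_smul (a : S) (m : M) (c : C) :
    balancedMk ρ τ (a • m) c = a • balancedMk ρ τ m c := by
  rw [balancedMk, balancedMk, ← map_smul, TensorProduct.smul_tmul']

end BalancedLift

section Generators

variable {X : Type u} [TopologicalSpace X] {s : ℕ} {f : Fin s → C(X, UnitAddCircle)} (z₀ : Bar f)
  [CWComplex (Set.univ : Set X)] (E : FundamentalGroupoid X ⥤ ModuleCat.{0} ℤ)

/-- The module of `q`-chains of `D_*`. -/
abbrev NovikovChains (q : ℕ) : Type u := BalancedTensor (coeffRep z₀ E) (chainRep z₀ q)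

/-- A cell of `X̃₊`, as a chain. -/
def unitCell {q : ℕ} (c : LiftedCell (univFunctor (base z₀)) q)
    (h : c.InPair (univPlus z₀) ∅) : PlusChains z₀ q :=
  single constInt (univPlus z₀) ∅ c h (1 : ℤ)

theorem chainRep_unitCell {q : ℕ} (g : piPlus z₀) (c : LiftedCell (univFunctor (base z₀)) q)
    (h : c.InPair (univPlus z₀) ∅) : chainRep z₀ q g (unitCell z₀ c h) =
      unitCell z₀ (actCell g.1 c) (actCell_inPair z₀ g c h) :=
  actChain_single z₀ q g c h (1 : ℤ)

theorem face_inPair_univPlus [T2Space X] [IsRegularCW X] {q m : ℕ}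
    (c : LiftedCell (univFunctor (base z₀)) q) (hc : c.InPair (univPlus z₀) ∅) (e : Cell X m)
    (h : IsFace c.cell e) : (c.face e h).InPair (univPlus z₀) ∅ :=
  ⟨(c.closed_face_subset e h).trans hc.1,
    fun h' => (h' (c.face e h).closed_nonempty.some_mem).elim⟩

open Classical in
theorem boundary_unitCell [T2Space X] [IsRegularCW X] [RelCWComplex.Finite (Set.univ : Set X)]
    (N : Incidence X) {q : ℕ} (c : LiftedCell (univFunctor (base z₀)) (q + 1))
    (hc : c.InPair (univPlus z₀) ∅) :
    boundary constInt (univPlus z₀) ∅ N q (unitCell z₀ c hc) =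
      ∑ e : Cell X q, N.num c.cell e • if h : IsFace c.cell e then
        unitCell z₀ (c.face e h) (face_inPair_univPlus z₀ c hc e h) else 0 := by
  refine (boundary_single constInt (univPlus z₀) ∅ N c hc (1 : ℤ)).trans ?_
  refine Finset.sum_congr rfl fun e _ => congrArg (N.num c.cell e • ·) ?_
  by_cases h : IsFace c.cell e
  · rw [dif_pos h]
    refine (faceChain_eq c e h _).trans ?_
    rw [singleOrZero_of_inPair (face_inPair_univPlus z₀ c hc e h)]
    rfl
  · rw [dif_neg h]
    exact faceChain_of_not c e h _

/-- Additive maps on the chains of `X̃₊` are determined by their values on the cells. -/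
theorem plusChains_hom_ext {q : ℕ} {Q : Type*} [AddCommMonoid Q] {α β : PlusChains z₀ q →+ Q}
    (h : ∀ c hc, α (unitCell z₀ c hc) = β (unitCell z₀ c hc)) : α = β := by
  classical
  refine DirectSum.addHom_ext' fun c => ?_
  let i : ℤ →+ PlusChains z₀ q := DirectSum.of
    (fun c : {c : LiftedCell (univFunctor (base z₀)) q // c.InPair (univPlus z₀) ∅} =>
      constInt.obj (center c.1.cell)) c
  refine AddMonoidHom.ext_int (f := α.comp i) (g := β.comp i) ?_
  have h1 : unitCell z₀ c.1 c.2 = i 1 := single_eq_lof constInt (univPlus z₀) ∅ c (1 : ℤ)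
  have h2 := h c.1 c.2
  rw [h1] at h2
  exact h2

/-- The element `(1 ⊗ m) ⊗ c` of `D_*`, for a cell `c` of `X̃₊` and `m` in the stalk at the base
point. -/
def generator {q : ℕ} (c : LiftedCell (univFunctor (base z₀)) q) (h : c.InPair (univPlus z₀) ∅) :
    E.obj (base z₀) →+ NovikovChains z₀ E q where
  toFun m := balancedMk (coeffRep z₀ E) (chainRep z₀ q) (1 ⊗ₜ[ℤ] m) (unitCell z₀ c h)
  map_zero' := by
    rw [balancedMk, TensorProduct.tmul_zero, TensorProduct.zero_tmul, map_zero]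
  map_add' m m' := by
    rw [balancedMk, TensorProduct.tmul_add, TensorProduct.add_tmul, map_add]
    rfl

theorem smul_generator {q : ℕ} (c : LiftedCell (univFunctor (base z₀)) q)
    (h : c.InPair (univPlus z₀) ∅) (P : MvPolynomial (Fin s) ℤ) (m : E.obj (base z₀)) :
    P • generator z₀ E c h m = balancedMk (coeffRep z₀ E) (chainRep z₀ q) (P ⊗ₜ[ℤ] m)
      (unitCell z₀ c h) := by
  refine (balancedMk_smul _ _ P _ _).symm.trans ?_
  rw [TensorProduct.smul_tmul', smul_eq_mul, mul_one]

variable {E} in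
theorem novikovChains_hom_ext {q : ℕ} {Q : Type*} [AddCommGroup Q]
    [Module (MvPolynomial (Fin s) ℤ) Q]
    {α β : NovikovChains z₀ E q →ₗ[MvPolynomial (Fin s) ℤ] Q}
    (h : ∀ c hc m, α (generator z₀ E c hc m) = β (generator z₀ E c hc m)) : α = β := by
  refine Submodule.linearMap_qext _ (LinearMap.ext fun y => ?_)
  induction y using TensorProduct.induction_on with
  | zero => rw [map_zero, map_zero]
  | add y y' hy hy' => rw [map_add, map_add, hy, hy']
  | tmul P x =>
    induction P using TensorProduct.induction_on with
    | zero => rw [TensorProduct.zero_tmul, map_zero, map_zero]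
    | add P P' hP hP' => rw [TensorProduct.add_tmul, map_add, map_add, hP, hP']
    | tmul P m =>
      have key : α.toAddMonoidHom.comp (balancedMkHom (coeffRep z₀ E) (chainRep z₀ q) (P ⊗ₜ[ℤ] m)) =
          β.toAddMonoidHom.comp
            (balancedMkHom (coeffRep z₀ E) (chainRep z₀ q) (P ⊗ₜ[ℤ] m)) := by
        refine plusChains_hom_ext z₀ fun c hc => ?_
        refine (congrArg α (smul_generator z₀ E c hc P m)).symm.trans
          (Eq.trans ?_ (congrArg β (smul_generator z₀ E c hc P m)))
        rw [map_smul, map_smul, h c hc m]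
      exact DFunLike.congr_fun key x

/-- The monomial by which an element of `π₁(X)₊` acts. -/
def degMonomial (g : piPlus z₀) : MvPolynomial (Fin s) ℤ :=
  ∏ i, MvPolynomial.X i ^ (PiOne.deg z₀ g.1 i).toNat

theorem generator_act {q : ℕ} (g : piPlus z₀) (c : LiftedCell (univFunctor (base z₀)) q)
    (h : c.InPair (univPlus z₀) ∅) (m : E.obj (base z₀)) :
    generator z₀ E (actCell g.1 c) (actCell_inPair z₀ g c h) m =
      degMonomial z₀ g • generator z₀ E c h ((E.map (PiOne.loop z₀ g.1)).hom m) := by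
  have h1 := balancedMk_act (coeffRep z₀ E) (chainRep z₀ q) g (1 ⊗ₜ[ℤ] m) (unitCell z₀ c h)
  rw [chainRep_unitCell] at h1
  refine h1.symm.trans ((smul_generator z₀ E c h _ _).trans ?_).symm
  refine congrArg (fun y => balancedMk (coeffRep z₀ E) (chainRep z₀ q) y _) ?_
  refine congrArg (· ⊗ₜ[ℤ] _) (mul_one _).symm

/-- The biadditive map `(P ⊗ m, c) ↦ P · θ c m`. -/
def novikovBilin {q : ℕ} {Q : Type*} [AddCommGroup Q] [Module (MvPolynomial (Fin s) ℤ) Q]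
    (θ : ∀ c : LiftedCell (univFunctor (base z₀)) q, c.InPair (univPlus z₀) ∅ →
      (E.obj (base z₀) →+ Q)) : Coeff z₀ E →+ PlusChains z₀ q →+ Q :=
  let _ : DecidableEq {c : LiftedCell (univFunctor (base z₀)) q // c.InPair (univPlus z₀) ∅} :=
    Classical.decEq _
  let γ : PlusChains z₀ q →+ E.obj (base z₀) →+ Q :=
    DirectSum.toAddMonoid fun c => (zmultiplesHom (E.obj (base z₀) →+ Q) (θ c.1 c.2) : ℤ →+ _)
  let β : MvPolynomial (Fin s) ℤ →+ E.obj (base z₀) →+ PlusChains z₀ q →+ Q :=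
    (AddMonoidHom.compHom.flip γ.flip).comp
      (AddMonoidHom.compHom.comp (smulAddHom (MvPolynomial (Fin s) ℤ) Q))
  TensorProduct.liftAddHom β fun n P m => by
    -- The module structure of the stalk over `ℤ` is not definitionally the one of its group.
    have h1 := map_intCast_smul (β P) ℤ ℤ n m
    have h2 := map_intCast_smul β ℤ ℤ n P
    rw [Int.cast_id] at h1 h2
    exact (DFunLike.congr_fun h2 m).trans h1.symm

theorem novikovBilin_single {q : ℕ} {Q : Type*} [AddCommGroup Q]
    [Module (MvPolynomial (Fin s) ℤ) Q]
    (θ : ∀ c : LiftedCell (univFunctor (base z₀)) q, c.InPair (univPlus z₀) ∅ →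
      (E.obj (base z₀) →+ Q)) (c) (h) (P) (m) :
    novikovBilin z₀ E θ (P ⊗ₜ[ℤ] m) (unitCell z₀ c h) = P • θ c h m := by
  classical
  let γ : PlusChains z₀ q →+ E.obj (base z₀) →+ Q :=
    DirectSum.toAddMonoid fun c => (zmultiplesHom (E.obj (base z₀) →+ Q) (θ c.1 c.2) : ℤ →+ _)
  have h1 : γ (unitCell z₀ c h) = θ c h := by
    rw [unitCell]
    refine (congrArg γ (single_eq_lof constInt (univPlus z₀) ∅ ⟨c, h⟩ (1 : ℤ))).trans ?_
    refine (DirectSum.toAddMonoid_of _ _ _).trans ?_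
    exact one_zsmul _
  have h2 : P • γ (unitCell z₀ c h) m = P • θ c h m := by rw [h1]
  convert! h2

/-- The linear map on the chains of `D_*` with prescribed values on the generators. -/
def novikovLift {q : ℕ} {Q : Type*} [AddCommGroup Q] [Module (MvPolynomial (Fin s) ℤ) Q]
    (θ : ∀ c : LiftedCell (univFunctor (base z₀)) q, c.InPair (univPlus z₀) ∅ →
      (E.obj (base z₀) →+ Q))
    (hθ : ∀ (g : piPlus z₀) (c) (h) (m), θ (actCell g.1 c) (actCell_inPair z₀ g c h) m =
      degMonomial z₀ g • θ c h ((E.map (PiOne.loop z₀ g.1)).hom m)) :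
    NovikovChains z₀ E q →ₗ[MvPolynomial (Fin s) ℤ] Q :=
  balancedLift (coeffRep z₀ E) (chainRep z₀ q) (novikovBilin z₀ E θ)
    (fun P y x => by
      induction y using TensorProduct.induction_on with
      | zero => rw [smul_zero, map_zero, AddMonoidHom.zero_apply, smul_zero]
      | add y y' hy hy' =>
        rw [smul_add, map_add, map_add, AddMonoidHom.add_apply, AddMonoidHom.add_apply, hy, hy',
          smul_add]
      | tmul P' m => exact mul_smul P P' _)
    (fun g y x => by
      induction y using TensorProduct.induction_on with
      | zero => rw [map_zero, map_zero, AddMonoidHom.zero_apply, AddMonoidHom.zero_apply]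
      | add y y' hy hy' =>
        rw [map_add, map_add, map_add, AddMonoidHom.add_apply, AddMonoidHom.add_apply, hy, hy']
      | tmul P m =>
        refine DFunLike.congr_fun (f := novikovBilin z₀ E θ (coeffRep z₀ E (MulOpposite.op g)
          (P ⊗ₜ[ℤ] m))) (g := (novikovBilin z₀ E θ (P ⊗ₜ[ℤ] m)).comp
            (chainRep z₀ q g).toAddMonoidHom) (plusChains_hom_ext z₀ fun c hc => ?_) x
        refine (novikovBilin_single z₀ E θ c hc _ _).trans (Eq.symm ?_)
        refine (congrArg (novikovBilin z₀ E θ (P ⊗ₜ[ℤ] m)) (chainRep_unitCell z₀ g c hc)).trans ?_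
        rw [novikovBilin_single, hθ g c hc m, smul_smul, mul_comm]
        rfl)

theorem novikovLift_generator {q : ℕ} {Q : Type*} [AddCommGroup Q]
    [Module (MvPolynomial (Fin s) ℤ) Q]
    (θ : ∀ c : LiftedCell (univFunctor (base z₀)) q, c.InPair (univPlus z₀) ∅ →
      (E.obj (base z₀) →+ Q))
    (hθ : ∀ (g : piPlus z₀) (c) (h) (m), θ (actCell g.1 c) (actCell_inPair z₀ g c h) m =
      degMonomial z₀ g • θ c h ((E.map (PiOne.loop z₀ g.1)).hom m)) (c) (h) (m) :
    novikovLift z₀ E θ hθ (generator z₀ E c h m) = θ c h m :=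
  (novikovBilin_single z₀ E θ c h 1 m).trans (one_smul _ _)

variable [T2Space X] [IsRegularCW X] [RelCWComplex.Finite (Set.univ : Set X)] (N : Incidence X)

/-- The boundary operator of `D_*`. -/
abbrev novikovBoundary (q : ℕ) :
    NovikovChains z₀ E (q + 1) →ₗ[MvPolynomial (Fin s) ℤ] NovikovChains z₀ E q :=
  balancedMap (coeffRep z₀ E) (chainRep z₀ (q + 1)) (chainRep z₀ q)
    (boundary constInt (univPlus z₀) ∅ N q) (boundary_act z₀ N q)

theorem novikovComplex_d (q : ℕ) :
    (novikovComplex z₀ N E).d (q + 1) q = ModuleCat.ofHom (novikovBoundary z₀ E N q) :=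
  ChainComplex.of_d (fun q => ModuleCat.of (MvPolynomial (Fin s) ℤ) (NovikovChains z₀ E q))
    (fun q => ModuleCat.ofHom (novikovBoundary z₀ E N q)) q

open Classical in
theorem novikovBoundary_generator {q : ℕ} (c : LiftedCell (univFunctor (base z₀)) (q + 1))
    (hc : c.InPair (univPlus z₀) ∅) (m : E.obj (base z₀)) :
    novikovBoundary z₀ E N q (generator z₀ E c hc m) =
      ∑ e : Cell X q, N.num c.cell e • if h : IsFace c.cell e then
        generator z₀ E (c.face e h) (face_inPair_univPlus z₀ c hc e h) m else 0 := by
  refine (congrArg (balancedMkHom (coeffRep z₀ E) (chainRep z₀ q) (1 ⊗ₜ[ℤ] m))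
    (boundary_unitCell z₀ N c hc)).trans ?_
  rw [map_sum]
  refine Finset.sum_congr rfl fun e _ => ?_
  rw [map_zsmul]
  refine congrArg (N.num c.cell e • ·) ?_
  by_cases h : IsFace c.cell e
  · rw [dif_pos h, dif_pos h]
    rfl
  · rw [dif_neg h, dif_neg h, map_zero]

end Generators

/-! ### Levels of the cells of the universal covering -/

section Levels

variable {X : Type u} [TopologicalSpace X] {s : ℕ} {f : Fin s → C(X, UnitAddCircle)}

/-- The degree maps `π₁(X)` onto `ℤ ^ s`, since its image is a subgroup that contains the basis. -/
theorem exists_deg_eq (z₀ : Bar f)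
    (hf : ∀ j : Fin s, ∃ l : PiOne z₀, PiOne.deg z₀ l = Pi.single j 1)
    (v : Fin s → ℤ) : ∃ g : PiOne z₀, PiOne.deg z₀ g = v := by
  have hmul : ∀ g h : PiOne z₀, PiOne.deg z₀ (g * h) = PiOne.deg z₀ g + PiOne.deg z₀ h :=
    fun g h => funext fun i => wind_comp _ _ i
  have hone : PiOne.deg z₀ 1 = 0 := funext fun i => wind_id (f := f) (base z₀) i
  let H : AddSubgroup (Fin s → ℤ) :=
    { carrier := {v | ∃ g, PiOne.deg z₀ g = v}
      zero_mem' := ⟨1, hone⟩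
      add_mem' := by
        rintro _ _ ⟨g, rfl⟩ ⟨h, rfl⟩
        exact ⟨g * h, hmul g h⟩
      neg_mem' := by
        rintro _ ⟨g, rfl⟩
        refine ⟨g⁻¹, eq_neg_of_add_eq_zero_left ?_⟩
        rw [← hmul, inv_mul_cancel, hone] }
  have hv : v = ∑ i, v i • Pi.single i (1 : ℤ) := by
    ext j
    simp [Finset.sum_apply, Pi.single_apply]
  change v ∈ H
  rw [hv]
  exact H.sum_mem fun i _ => H.zsmul_mem (hf i) _

variable [CWComplex (Set.univ : Set X)]

/-- The path from the base point that represents the centre of a cell of the universal covering. -/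
def LiftedCell.path {x₀ : FundamentalGroupoid X} {q : ℕ} (c : LiftedCell (univFunctor x₀) q) :
    x₀ ⟶ center c.cell := c.pt

variable (f) in
/-- The lower integral bound of the height on the cell of `X̃` given by the path `p` from the base
point to the centre of a cell. -/
def pathLevel (z₀ : Bar f) {x : FundamentalGroupoid X} (p : base z₀ ⟶ x) (i : Fin s) : ℤ :=
  ⌊(barLift p (basePoint z₀)).1 i⌋

omit [CWComplex (Set.univ : Set X)] in
theorem pathLevel_comp (z₀ : Bar f) {x y : FundamentalGroupoid X} (p : base z₀ ⟶ x) (γ : x ⟶ y)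
    (i : Fin s) : pathLevel f z₀ (p ≫ γ) i = pathLevel f z₀ p i + wind f γ i := by
  rw [pathLevel, pathLevel, wind_eq γ (barLift p (basePoint z₀)), barLift_comp]
  ring

omit [CWComplex (Set.univ : Set X)] in
theorem pathLevel_loop_comp (z₀ : Bar f) {x : FundamentalGroupoid X} (g : PiOne z₀)
    (p : base z₀ ⟶ x) (i : Fin s) :
    pathLevel f z₀ (PiOne.loop z₀ g ≫ p) i = PiOne.deg z₀ g i + pathLevel f z₀ p i := by
  rw [pathLevel, pathLevel, barLift_comp, add_comm, ← Int.floor_add_intCast]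
  exact congrArg _ (barLift_add p _ _ i _ (barLift_loop _ _ i))

variable [IsRegularCW X]
  (hN : ∀ (i : Fin s) (q : ℕ) (e : Cell X q), (openCell e ∩ f i ⁻¹' {0}).Nonempty →
    openCell e ⊆ f i ⁻¹' {0})
include hN

theorem LiftedCell.floor_le_height {q : ℕ} (c : LiftedCell (barFunctor f) q)
    {z : Total (barFunctor f)} (hz : z ∈ c.closed) (i : Fin s) :
    ⌊c.pt.1 i⌋ ≤ (toBar f z).height i := by
  obtain h | ⟨h, -⟩ := c.height_dichotomy hN i
  · exact (h z hz).ge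
  · exact (h z hz).1

/-- Heights do not decrease by a whole unit on the way from the centre of a cell to the
centre of a face. -/
theorem wind_faceHom_nonneg {q m : ℕ} {e : Cell X q} {e' : Cell X m} (h : IsFace e e')
    (i : Fin s) : 0 ≤ wind f (faceHom e e' h) i := by
  let c : LiftedCell (barFunctor f) q := ⟨e, stdPoint f (center e)⟩
  have h1 := c.floor_le_height hN (z := ⟨center e', barLift (faceHom e e' h) c.pt⟩)
    ⟨h (center_mem e'), rfl⟩ i
  exact sub_nonneg.2 (Int.le_floor.2 h1)

/-- A cell of `X̃` lies in `X̃₊` if and only if its levels are nonnegative. -/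
theorem inPair_univPlus_iff {z₀ : Bar f} {q : ℕ} (c : LiftedCell (univFunctor (base z₀)) q) :
    c.InPair (univPlus z₀) ∅ ↔ ∀ i, 0 ≤ pathLevel f z₀ c.path i := by
  constructor
  · intro h i
    exact Int.floor_nonneg.2 (h.1 c.center_mem_opened.1 i)
  · intro h
    refine ⟨?_, fun h' => (h' c.center_mem_opened.1).elim⟩
    rintro ⟨x, p⟩ ⟨hx, hp⟩ i
    have hp : c.path ≫ radial c.cell x hx = p := hp
    let c' : LiftedCell (barFunctor f) q := ⟨c.cell, barLift c.path (basePoint z₀)⟩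
    have h1 := c'.floor_le_height hN (z := ⟨x, barLift (radial c.cell x hx) c'.pt⟩) ⟨hx, rfl⟩ i
    have h2 : (0 : ℝ) ≤ (barLift (radial c.cell x hx) (barLift c.path (basePoint z₀))).1 i :=
      le_trans (by exact_mod_cast h i) h1
    rw [← barLift_comp, hp] at h2
    exact h2

omit [CWComplex (Set.univ : Set X)] [IsRegularCW X] hN in
theorem exists_pathLevel_eq_zero [PathConnectedSpace X] (z₀ : Bar f)
    (hf : ∀ j : Fin s, ∃ l : PiOne z₀, PiOne.deg z₀ l = Pi.single j 1)
    (x : FundamentalGroupoid X) : ∃ p : base z₀ ⟶ x, pathLevel f z₀ p = 0 := by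
  obtain ⟨γ⟩ := PathConnectedSpace.joined z₀.proj x.as
  let p : base z₀ ⟶ x := Path.Homotopic.Quotient.mk γ
  obtain ⟨g, hg⟩ := exists_deg_eq z₀ hf (-pathLevel f z₀ p)
  refine ⟨PiOne.loop z₀ g ≫ p, funext fun i => ?_⟩
  rw [pathLevel_loop_comp, hg]
  exact neg_add_cancel _

end Levels

/-! ### The specializations of `D_*` -/

section Models

variable {X : Type u} [TopologicalSpace X] {s : ℕ} {f : Fin s → C(X, UnitAddCircle)} (z₀ : Bar f)
  [CWComplex (Set.univ : Set X)] (E : FundamentalGroupoid X ⥤ ModuleCat.{0} ℤ)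
  {K : Type} [CommRing K] (a : Fin s → K)

/-- Additive maps are semilinear over the canonical homomorphism from `ℤ`. -/
def intSemilinear {M N : Type*} [AddCommGroup M] [Module ℤ M] [AddCommGroup N] [Module K N]
    (g : M →+ N) : M →ₛₗ[Int.castRingHom K] N where
  toFun := g
  map_add' := map_add g
  map_smul' n x := by
    have h := map_intCast_smul g ℤ K n x
    rw [Int.cast_id] at h
    exact h

/-- A linear map into a restriction of scalars, as a semilinear map. -/
def semilinearOfRestrict {R S : Type*} [CommRing R] [CommRing S] (φ : R →+* S) {M N : Type*}
    [AddCommGroup M] [Module R M] [AddCommGroup N] [Module S N]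
    (g : M →ₗ[R] (ModuleCat.restrictScalars φ).obj (ModuleCat.of S N)) : M →ₛₗ[φ] N where
  toFun := g
  map_add' := map_add g
  map_smul' := map_smul g

/-- The product of the `a i ^ n i`, with negative exponents replaced by `0`. -/
def power (n : Fin s → ℤ) : K := ∏ i, a i ^ (n i).toNat

theorem power_add {m n : Fin s → ℤ} (hm : ∀ i, 0 ≤ m i) (hn : ∀ i, 0 ≤ n i) :
    power a (fun i => m i + n i) = power a m * power a n := by
  simp only [power, ← Finset.prod_mul_distrib, ← pow_add]
  exact Finset.prod_congr rfl fun i _ => by rw [Int.toNat_add (hm i) (hn i)]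

theorem power_zero : power a 0 = 1 := by simp [power]

/-- Evaluation of integral polynomials at `a`. -/
abbrev evalAt : MvPolynomial (Fin s) ℤ →+* K := MvPolynomial.eval₂Hom (Int.castRingHom K) a

omit [CWComplex (Set.univ : Set X)] in
theorem evalAt_degMonomial (g : piPlus z₀) :
    evalAt a (degMonomial z₀ g) = power a (PiOne.deg z₀ g.1) := by
  simp [degMonomial, power]

variable {z₀ E a} in
/-- Linear maps on `K_a ⊗ D_*` are determined by their values on the generators. -/
theorem specialization_hom_ext {q : ℕ} {W : Type u} [AddCommGroup W] [Module K W]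
    {α β : (ModuleCat.extendScalars (evalAt a)).obj (ModuleCat.of _ (NovikovChains z₀ E q)) →ₗ[K] W}
    (h : ∀ c hc m,
      α (extIncl (evalAt a) (ModuleCat.of _ (NovikovChains z₀ E q)) (generator z₀ E c hc m)) =
        β (extIncl (evalAt a) (ModuleCat.of _ (NovikovChains z₀ E q)) (generator z₀ E c hc m))) :
    α = β := by
  let r : ((ModuleCat.extendScalars (evalAt a)).obj (ModuleCat.of _ (NovikovChains z₀ E q)) →ₗ[K]
      W) → (NovikovChains z₀ E q →ₗ[MvPolynomial (Fin s) ℤ]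
        (ModuleCat.restrictScalars (evalAt a)).obj (ModuleCat.of K W)) := fun α =>
    { toFun := fun x => α (extIncl (evalAt a) (ModuleCat.of _ (NovikovChains z₀ E q)) x)
      map_add' := fun x y => (congrArg α (map_add
        (extIncl (evalAt a) (ModuleCat.of _ (NovikovChains z₀ E q))) x y)).trans (map_add α _ _)
      map_smul' := fun P x =>
        (congrArg α ((extIncl (evalAt a) (ModuleCat.of _ (NovikovChains z₀ E q))).map_smulₛₗ P
          x)).trans (map_smul α _ _) }
  have h1 : r α = r β := novikovChains_hom_ext z₀ h
  exact extendScalars_hom_ext (evalAt a) fun x => LinearMap.congr_fun h1 x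

variable (f) in
/-- A description of the complex `K_a ⊗ D_*` as the cellular complex of a pair `(A, B)` in a
covering: `(A, B)` contains exactly one lift of each cell of `X`, and when the stalks of `L` are
identified with those of `K ⊗ E`, the face of the lift of `e` over `e'` occurs with the weight
`∏ a i ^ n i`, where the `n i` are the windings of the radius from `e` to `e'`. -/
structure SpecializationModel {F : FundamentalGroupoid X ⥤ Type}
    (L : FundamentalGroupoid X ⥤ ModuleCat.{0} K) (A B : Set (Total F)) where
  /-- The lift of the centre of a cell. -/
  pt : ∀ {q : ℕ} (e : Cell X q), F.obj (center e)
  inPair : ∀ {q : ℕ} (e : Cell X q), LiftedCell.InPair A B ⟨e, pt e⟩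
  eq_pt : ∀ {q : ℕ} (e : Cell X q) (p : F.obj (center e)), LiftedCell.InPair A B ⟨e, p⟩ → p = pt e
  /-- The identification of the stalks. -/
  stalk : ∀ x, (scalarSystem K E).obj x ≃ₗ[K] L.obj x
  faceChain_eq : ∀ {q m : ℕ} (e : Cell X q) (e' : Cell X m) (h : IsFace e e')
    (y : (scalarSystem K E).obj (center e)),
    faceChain L A B ⟨e, pt e⟩ e' (stalk _ y) = power a (wind f (faceHom e e' h)) •
      single L A B ⟨e', pt e'⟩ (inPair e')
        (stalk _ (((scalarSystem K E).map (faceHom e e' h)).hom y))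

namespace SpecializationModel

variable {E a} {F : FundamentalGroupoid X ⥤ Type} {L : FundamentalGroupoid X ⥤ ModuleCat.{0} K}
  {A B : Set (Total F)} (𝓜 : SpecializationModel f E a L A B)

/-- The image of a generator of `D_*` before its multiplication with a power of `a`: the chain
`y · e`, with `y` the transport of `m` along the path that defines the cell of `X̃`. -/
def term {q : ℕ} (c : LiftedCell (univFunctor (base z₀)) q) : E.obj (base z₀) →+ Chains L A B q :=
  ((single L A B ⟨c.cell, 𝓜.pt c.cell⟩ (𝓜.inPair c.cell)).toAddMonoidHom.comp
    (𝓜.stalk _).toLinearMap.toAddMonoidHom).comp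
    ((extIncl (Int.castRingHom K) (E.obj (center c.cell))).toAddMonoidHom.comp
      (E.map c.path).hom.toAddMonoidHom)

/-- The image of a generator of `D_*`. -/
def value {q : ℕ} (c : LiftedCell (univFunctor (base z₀)) q) :
    E.obj (base z₀) →+
      (ModuleCat.restrictScalars (evalAt a)).obj (ModuleCat.of K (Chains L A B q)) :=
  (DistribSMul.toAddMonoidHom (Chains L A B q) (power a (pathLevel f z₀ c.path))).comp
    (𝓜.term z₀ c)

variable [IsRegularCW X]
  (hN : ∀ (i : Fin s) (q : ℕ) (e : Cell X q), (openCell e ∩ f i ⁻¹' {0}).Nonempty →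
    openCell e ⊆ f i ⁻¹' {0})

include hN in
theorem value_act {q : ℕ} (g : piPlus z₀) (c : LiftedCell (univFunctor (base z₀)) q)
    (h : c.InPair (univPlus z₀) ∅) (m : E.obj (base z₀)) :
    𝓜.value z₀ (actCell g.1 c) m =
      degMonomial z₀ g • 𝓜.value z₀ c ((E.map (PiOne.loop z₀ g.1)).hom m) := by
  have h1 : pathLevel f z₀ (actCell g.1 c).path =
      fun i => PiOne.deg z₀ g.1 i + pathLevel f z₀ c.path i :=
    funext fun i => pathLevel_loop_comp z₀ g.1 c.path i
  have h2 : 𝓜.term z₀ (actCell g.1 c) m = 𝓜.term z₀ c ((E.map (PiOne.loop z₀ g.1)).hom m) := by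
    have h3 : (E.map (PiOne.loop z₀ g.1 ≫ c.path)).hom m =
        (E.map c.path).hom
          ((E.map (PiOne.loop z₀ g.1)).hom m) := by
      rw [E.map_comp]
      rfl
    exact congrArg (fun y => single L A B ⟨c.cell, 𝓜.pt c.cell⟩ (𝓜.inPair c.cell)
      (𝓜.stalk _ (extIncl (Int.castRingHom K) (E.obj (center c.cell)) y))) h3
  change power a (pathLevel f z₀ (actCell g.1 c).path) • 𝓜.term z₀ (actCell g.1 c) m =
    evalAt a (degMonomial z₀ g) • power a (pathLevel f z₀ c.path) • 𝓜.term z₀ c _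
  rw [h1, h2, evalAt_degMonomial, smul_smul, power_add a g.2 ((inPair_univPlus_iff hN c).1 h)]

/-- The comparison map before the extension of scalars. -/
def forwardRestrict (q : ℕ) : NovikovChains z₀ E q →ₗ[MvPolynomial (Fin s) ℤ]
    (ModuleCat.restrictScalars (evalAt a)).obj (ModuleCat.of K (Chains L A B q)) :=
  novikovLift z₀ E
    (Q := (ModuleCat.restrictScalars (evalAt a)).obj (ModuleCat.of K (Chains L A B q)))
    (fun c _ => 𝓜.value z₀ c) fun g c h m => 𝓜.value_act z₀ hN g c h m

/-- The comparison map from `K_a ⊗ D_*`. -/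
def forward (q : ℕ) :
    (ModuleCat.extendScalars (evalAt a)).obj (ModuleCat.of _ (NovikovChains z₀ E q)) →ₗ[K]
      Chains L A B q :=
  extLift (evalAt a) _ (semilinearOfRestrict (N := Chains L A B q) (evalAt a)
    (𝓜.forwardRestrict z₀ hN q))

theorem forward_generator {q : ℕ} (c : LiftedCell (univFunctor (base z₀)) q) (h) (m) :
    𝓜.forward z₀ hN q (extIncl (evalAt a) (ModuleCat.of _ (NovikovChains z₀ E q))
      (generator z₀ E c h m)) = power a (pathLevel f z₀ c.path) • 𝓜.term z₀ c m :=
  (extLift_incl (evalAt a) _ _ _).trans (novikovLift_generator z₀ E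
    (Q := (ModuleCat.restrictScalars (evalAt a)).obj (ModuleCat.of K (Chains L A B q)))
    (fun c _ => 𝓜.value z₀ c) (fun g c h m => 𝓜.value_act z₀ hN g c h m) c h m)

variable [PathConnectedSpace X]
  (hf : ∀ j : Fin s, ∃ l : PiOne z₀, PiOne.deg z₀ l = Pi.single j 1)

/-- A path from the base point to the given point whose lift to `X̄` ends with all heights in
`[0, 1)`. -/
def basePath (x : FundamentalGroupoid X) : base z₀ ⟶ x :=
  (exists_pathLevel_eq_zero z₀ hf x).choose

omit [CWComplex (Set.univ : Set X)] [IsRegularCW X] in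
theorem pathLevel_basePath (x : FundamentalGroupoid X) :
    pathLevel f z₀ (basePath z₀ hf x) = 0 :=
  (exists_pathLevel_eq_zero z₀ hf x).choose_spec

/-- The lift of a cell of `X` to the fundamental domain of `X̃₊`. -/
def baseCell {q : ℕ} (e : Cell X q) : LiftedCell (univFunctor (base z₀)) q :=
  ⟨e, basePath z₀ hf (center e)⟩

include hN in
theorem baseCell_inPair {q : ℕ} (e : Cell X q) :
    (baseCell z₀ hf e).InPair (univPlus z₀) ∅ :=
  (inPair_univPlus_iff hN _).2 fun i => (congrFun (pathLevel_basePath z₀ hf (center e)) i).ge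

variable (E a) in
/-- The inverse comparison map on the stalk at the centre of a cell: it transports the coefficient
back to the base point along the path that defines the cell of the fundamental domain. -/
def backwardStalk {q : ℕ} (e : Cell X q) : (scalarSystem K E).obj (center e) →ₗ[K]
    (ModuleCat.extendScalars (evalAt a)).obj (ModuleCat.of _ (NovikovChains z₀ E q)) :=
  extLift (Int.castRingHom K) (E.obj (center e)) (intSemilinear
    ((extIncl (evalAt a) (ModuleCat.of _ (NovikovChains z₀ E q))).toAddMonoidHom.comp
      ((generator z₀ E (baseCell z₀ hf e) (baseCell_inPair z₀ hN hf e)).comp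
        (E.map (inv (basePath z₀ hf (center e)))).hom.toAddMonoidHom)))

open Classical in
/-- The inverse of the comparison map. -/
def backward (q : ℕ) : Chains L A B q →ₗ[K]
    (ModuleCat.extendScalars (evalAt a)).obj (ModuleCat.of _ (NovikovChains z₀ E q)) :=
  DirectSum.toModule K _ _ fun c =>
    (backwardStalk z₀ E a hN hf c.1.cell).comp (𝓜.stalk (center c.1.cell)).symm.toLinearMap

theorem backward_single {q : ℕ} (c : LiftedCell F q) (h : c.InPair A B)
    (x : E.obj (center c.cell)) :
    𝓜.backward z₀ hN hf q (single L A B c h (𝓜.stalk _ (extIncl (Int.castRingHom K) _ x))) =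
      extIncl (evalAt a) (ModuleCat.of _ (NovikovChains z₀ E q))
        (generator z₀ E (baseCell z₀ hf c.cell) (baseCell_inPair z₀ hN hf c.cell)
          ((E.map (inv (basePath z₀ hf (center c.cell)))).hom x)) := by
  rw [backward, single]
  erw [DirectSum.toModule_lof]
  rw [LinearMap.comp_apply]
  refine (congrArg (backwardStalk z₀ E a hN hf c.cell)
    ((𝓜.stalk _).symm_apply_apply _)).trans ?_
  exact extLift_incl _ _ _ _

theorem forward_backward (q : ℕ) :
    (𝓜.forward z₀ hN q).comp (𝓜.backward z₀ hN hf q) = LinearMap.id := by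
  refine chains_ext _ _ _ fun c hc y => ?_
  obtain ⟨e, p⟩ := c
  obtain rfl := 𝓜.eq_pt e p hc
  obtain ⟨y, rfl⟩ := (𝓜.stalk _).surjective y
  refine LinearMap.congr_fun (f := ((𝓜.forward z₀ hN q).comp (𝓜.backward z₀ hN hf q)).comp
    ((single L A B ⟨e, 𝓜.pt e⟩ hc).comp (𝓜.stalk (center e)).toLinearMap))
    (g := (single L A B ⟨e, 𝓜.pt e⟩ hc).comp (𝓜.stalk (center e)).toLinearMap)
    (extendScalars_hom_ext (Int.castRingHom K) fun x => ?_) y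
  refine (congrArg (𝓜.forward z₀ hN q) (𝓜.backward_single z₀ hN hf ⟨e, 𝓜.pt e⟩ hc x)).trans ?_
  refine (𝓜.forward_generator z₀ hN _ _ _).trans ?_
  have h1 : power a (pathLevel f z₀ (baseCell z₀ hf e).path) = 1 :=
    (congrArg (power a) (pathLevel_basePath z₀ hf (center e))).trans (power_zero a)
  have h2 : (E.map (basePath z₀ hf (center e))).hom
      ((E.map (inv (basePath z₀ hf (center e)))).hom x) = x := by
    rw [← ModuleCat.comp_apply, ← E.map_comp, IsIso.inv_hom_id, E.map_id]
    rfl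
  refine (congrArg (· • _) h1).trans ((one_smul _ _).trans ?_)
  exact congrArg (fun y => single L A B ⟨e, 𝓜.pt e⟩ (𝓜.inPair e)
      (𝓜.stalk _ (extIncl (Int.castRingHom K) (E.obj (center e)) y))) h2

theorem backward_forward (q : ℕ) :
    (𝓜.backward z₀ hN hf q).comp (𝓜.forward z₀ hN q) = LinearMap.id := by
  refine specialization_hom_ext fun c hc m => ?_
  -- The cell `c` is the translate of the cell of the fundamental domain by the loop that follows
  -- the path of `c` and returns along the base path; its degree is the level of `c`.
  let p : base z₀ ⟶ center c.cell := c.path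
  let p₀ : base z₀ ⟶ center c.cell := basePath z₀ hf (center c.cell)
  have : IsIso p₀ := IsIso.of_groupoid p₀
  have hp : ∀ i, 0 ≤ pathLevel f z₀ p i := (inPair_univPlus_iff hN c).1 hc
  let l : base z₀ ⟶ base z₀ := p ≫ inv p₀
  have hl : l ≫ p₀ = p := by
    rw [Category.assoc, IsIso.inv_hom_id, Category.comp_id]
  have hdeg : PiOne.deg z₀ (MulOpposite.op l) = pathLevel f z₀ p := funext fun i => by
    have h2 := pathLevel_loop_comp z₀ (MulOpposite.op l) p₀ i
    rw [pathLevel_basePath z₀ hf, Pi.zero_apply, add_zero] at h2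
    exact h2.symm.trans (congrArg (pathLevel f z₀ · i) hl)
  let g : piPlus z₀ := ⟨MulOpposite.op l, fun i => (hp i).trans_eq (congrFun hdeg i).symm⟩
  have hc' : actCell g.1 (baseCell z₀ hf c.cell) = c :=
    congrArg (LiftedCell.mk (F := univFunctor (base z₀)) c.cell) hl
  have hgen : generator z₀ E c hc m = degMonomial z₀ g • generator z₀ E (baseCell z₀ hf c.cell)
      (baseCell_inPair z₀ hN hf c.cell) ((E.map (PiOne.loop z₀ g.1)).hom m) := by
    rw [← generator_act]
    have h1 : ∀ c₁ h₁, c₁ = c → generator z₀ E c hc m = generator z₀ E c₁ h₁ m := by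
      rintro _ _ rfl
      rfl
    exact h1 _ _ hc'
  have hE : (E.map (PiOne.loop z₀ g.1)).hom m =
      (E.map (inv p₀)).hom ((E.map p).hom m) := by
    change (E.map l).hom m = _
    rw [E.map_comp]
    rfl
  refine (congrArg (𝓜.backward z₀ hN hf q) (𝓜.forward_generator z₀ hN c hc m)).trans ?_
  refine (map_smul (𝓜.backward z₀ hN hf q) _ _).trans ?_
  refine (congrArg (power a (pathLevel f z₀ c.path) • ·) (𝓜.backward_single z₀ hN hf
    ⟨c.cell, 𝓜.pt c.cell⟩ (𝓜.inPair c.cell) ((E.map p).hom m))).trans (Eq.symm ?_)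
  refine (congrArg (extIncl (evalAt a) _) hgen).trans ?_
  refine ((extIncl (evalAt a) _).map_smulₛₗ _ _).trans ?_
  rw [evalAt_degMonomial, hE]
  exact congrArg (fun n => power a n • _) hdeg

/-- In each degree, `K_a ⊗ D_*` is isomorphic to the chains of the pair. -/
def equiv (q : ℕ) :
    (ModuleCat.extendScalars (evalAt a)).obj (ModuleCat.of _ (NovikovChains z₀ E q)) ≃ₗ[K]
      Chains L A B q :=
  LinearEquiv.ofLinearMap (𝓜.forward z₀ hN q) (𝓜.backward z₀ hN hf q)
    (𝓜.forward_backward z₀ hN hf q) (𝓜.backward_forward z₀ hN hf q)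

variable [T2Space X] [RelCWComplex.Finite (Set.univ : Set X)] (N : Incidence X)

omit [PathConnectedSpace X] in
theorem boundary_forward (q : ℕ) :
    (boundary L A B N q).comp (𝓜.forward z₀ hN (q + 1)) = (𝓜.forward z₀ hN q).comp
      ((ModuleCat.extendScalars (evalAt a)).map
        (ModuleCat.ofHom (novikovBoundary z₀ E N q))).hom := by
  classical
  refine specialization_hom_ext fun c hc m => ?_
  let p : base z₀ ⟶ center c.cell := c.path
  let y := extIncl (Int.castRingHom K) (E.obj (center c.cell)) ((E.map p).hom m)
  have hl : boundary L A B N q (𝓜.forward z₀ hN (q + 1) (extIncl (evalAt a) _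
      (generator z₀ E c hc m))) = power a (pathLevel f z₀ c.path) • ∑ e : Cell X q,
        N.num c.cell e • faceChain L A B ⟨c.cell, 𝓜.pt c.cell⟩ e (𝓜.stalk _ y) := by
    rw [𝓜.forward_generator z₀ hN c hc m, map_smul]
    exact congrArg _ (boundary_single L A B N ⟨c.cell, 𝓜.pt c.cell⟩ (𝓜.inPair c.cell) _)
  let ψ : NovikovChains z₀ E q →+ Chains L A B q :=
    (𝓜.forward z₀ hN q).toAddMonoidHom.comp
      (extIncl (evalAt a) (ModuleCat.of _ (NovikovChains z₀ E q))).toAddMonoidHom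
  have hr : 𝓜.forward z₀ hN q (((ModuleCat.extendScalars (evalAt a)).map
      (ModuleCat.ofHom (novikovBoundary z₀ E N q))).hom (extIncl (evalAt a) _
        (generator z₀ E c hc m))) = ∑ e : Cell X q, N.num c.cell e •
          ψ (if h : IsFace c.cell e then
            generator z₀ E (c.face e h) (face_inPair_univPlus z₀ c hc e h) m else 0) := by
    have h1 := congrArg ψ (novikovBoundary_generator z₀ E N c hc m)
    rw [map_sum] at h1
    simp only [map_zsmul] at h1
    exact h1
  refine hl.trans (Eq.trans ?_ hr.symm)
  rw [Finset.smul_sum]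
  refine Finset.sum_congr rfl fun e _ => ?_
  rw [smul_comm]
  refine congrArg (N.num c.cell e • ·) ?_
  by_cases h : IsFace c.cell e
  · rw [dif_pos h]
    refine Eq.trans ?_ (𝓜.forward_generator z₀ hN (c.face e h)
      (face_inPair_univPlus z₀ c hc e h) m).symm
    rw [𝓜.faceChain_eq c.cell e h y, smul_smul]
    have h1 : pathLevel f z₀ (c.face e h).path =
        fun i => pathLevel f z₀ c.path i + wind f (faceHom c.cell e h) i :=
      funext fun i => pathLevel_comp z₀ p (faceHom c.cell e h) i
    rw [h1, power_add a ((inPair_univPlus_iff hN c).1 hc) (wind_faceHom_nonneg hN h)]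
    refine congrArg (_ • ·) ?_
    have h2 : (E.map (faceHom c.cell e h)).hom ((E.map p).hom m) =
        (E.map (p ≫ faceHom c.cell e h)).hom m := by
      rw [E.map_comp]
      rfl
    exact congrArg (fun y => single L A B ⟨e, 𝓜.pt e⟩ (𝓜.inPair e)
      (𝓜.stalk _ (extIncl (Int.castRingHom K) (E.obj (center e)) y))) h2
  · rw [dif_neg h, map_zero]
    exact (congrArg (power a _ • ·) (faceChain_of_not ⟨c.cell, 𝓜.pt c.cell⟩ e h
      (𝓜.stalk _ y))).trans (smul_zero _)

/-- The complex `K_a ⊗ D_*` is isomorphic to the cellular complex of the pair. -/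
def complexIso : evalComplex N z₀ E K a ≅ chainComplex L A B N :=
  HomologicalComplex.Hom.isoOfComponents (fun q => (𝓜.equiv z₀ hN hf q).toModuleIso) <| by
    rintro _ q rfl
    rw [chainComplex_d]
    have h1 : (evalComplex N z₀ E K a).d (q + 1) q = (ModuleCat.extendScalars (evalAt a)).map
        (ModuleCat.ofHom (novikovBoundary z₀ E N q)) :=
      congrArg (ModuleCat.extendScalars (evalAt a)).map (novikovComplex_d z₀ E N q)
    rw [h1]
    exact ModuleCat.hom_ext (𝓜.boundary_forward z₀ hN N q)

end SpecializationModel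

end Models

/-! ### The specialization at a point of the torus -/

section Torus

variable {X : Type u} [TopologicalSpace X] {s : ℕ} (f : Fin s → C(X, UnitAddCircle))
  [CWComplex (Set.univ : Set X)] [IsRegularCW X] [T2Space X]
  (hN : ∀ (i : Fin s) (q : ℕ) (e : Cell X q), (openCell e ∩ f i ⁻¹' {0}).Nonempty →
    openCell e ⊆ f i ⁻¹' {0})
  (E : FundamentalGroupoid X ⥤ ModuleCat.{0} ℤ) (a : Fin s → ℂˣ)

omit [IsRegularCW X] in
theorem inPair_univ_empty {F : FundamentalGroupoid X ⥤ Type w} {q : ℕ} (c : LiftedCell F q) :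
    c.InPair Set.univ ∅ :=
  ⟨Set.subset_univ _, fun h => (h c.closed_nonempty.some_mem).elim⟩

/-- `ℂ_a ⊗ D_*` is the cellular complex of `X` with coefficients in `a ^ α ⊗ E`: the fibre of the
flat line bundle over every point is `ℂ`, and the powers of `a` in the boundary of a cell are the
transports of this bundle. -/
def torusModel : SpecializationModel f E (fun i => (a i : ℂ))
    (F := (Functor.const _).obj PUnit.{1}) (powerSystem f a ⊗ scalarSystem ℂ E) Set.univ ∅ where
  pt _ := PUnit.unit
  inPair _ := inPair_univ_empty _
  eq_pt _ _ _ := rfl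
  stalk x := (TensorProduct.lid ℂ ((scalarSystem ℂ E).obj x)).symm
  faceChain_eq e e' h y := by
    have h1 : power (fun i => (a i : ℂ)) (wind f (faceHom e e' h)) =
        ((∏ i, a i ^ wind f (faceHom e e' h) i : ℂˣ) : ℂ) := by
      rw [power, Units.coe_prod]
      refine Finset.prod_congr rfl fun i _ => ?_
      obtain ⟨n, hn⟩ := Int.eq_ofNat_of_zero_le (wind_faceHom_nonneg hN h i)
      simp [hn]
    have h2 : LiftedCell.InPair (F := (Functor.const (FundamentalGroupoid X)).obj PUnit.{1})
      Set.univ ∅ (⟨e', PUnit.unit⟩ : LiftedCell _ _) := inPair_univ_empty _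
    rw [h1]
    refine (faceChain_eq _ e' h _).trans ?_
    refine (LinearMap.congr_fun (singleOrZero_of_inPair h2) _).trans (Eq.trans ?_ (map_smul _ _ _))
    refine congrArg (single _ _ _ _ h2) ?_
    have h3 : ∀ {M : Type} [AddCommGroup M] [Module ℂ M] (r : ℂ) (z : M),
        (r • (1 : ℂ)) ⊗ₜ[ℂ] z = r • ((1 : ℂ) ⊗ₜ[ℂ] z) := fun r z => rfl
    exact h3 ((∏ i, a i ^ wind f (faceHom e e' h) i : ℂˣ) : ℂ)
      (((scalarSystem ℂ E).map (faceHom e e' h)).hom y)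

end Torus

/-! ### The specialization at the origin -/

section Origin

variable {X : Type u} [TopologicalSpace X] {s : ℕ} {f : Fin s → C(X, UnitAddCircle)}
  [CWComplex (Set.univ : Set X)] [IsRegularCW X] [T2Space X]
  (hN : ∀ (i : Fin s) (q : ℕ) (e : Cell X q), (openCell e ∩ f i ⁻¹' {0}).Nonempty →
    openCell e ⊆ f i ⁻¹' {0})
  (E : FundamentalGroupoid X ⥤ ModuleCat.{0} ℤ) (K : Type) [CommRing K]

omit [CWComplex (Set.univ : Set X)] [IsRegularCW X] [T2Space X] in
theorem floor_stdPoint (x : FundamentalGroupoid X) (i : Fin s) : ⌊(stdPoint f x).1 i⌋ = 0 := by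
  have h := (AddCircle.equivIco 1 0 (f i x.as)).2
  exact Int.floor_eq_zero_iff.2 ⟨h.1, h.2.trans_eq (zero_add 1)⟩

omit [CWComplex (Set.univ : Set X)] [IsRegularCW X] [T2Space X] in
theorem eq_stdPoint {x : FundamentalGroupoid X} (p : BarFibre f x) (h : ∀ i, ⌊p.1 i⌋ = 0) :
    p = stdPoint f x := by
  refine Subtype.ext (funext fun i => ?_)
  obtain ⟨k, hk⟩ := exists_int_barFibre (stdPoint f x) p i
  have h1 := h i
  rw [hk, Int.floor_add_intCast, floor_stdPoint, zero_add] at h1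
  rw [hk, h1, Int.cast_zero, add_zero]

include hN in
omit [T2Space X] in
/-- The cells of `X̄₀` outside `N̄₀⁺` are those whose heights have integral lower bound `0`. -/
theorem LiftedCell.inPair_domain_iff {q : ℕ} (c : LiftedCell (barFunctor f) q) :
    c.InPair (toBar f ⁻¹' domain f) (toBar f ⁻¹' upperBoundary f) ↔ ∀ i, ⌊c.pt.1 i⌋ = 0 := by
  have hc := c.center_mem_opened
  constructor
  · rintro ⟨h1, h2⟩ i
    obtain ⟨h3, h4⟩ : 0 ≤ c.pt.1 i ∧ c.pt.1 i ≤ 1 := h1 hc.1 i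
    refine Int.floor_eq_zero_iff.2 ⟨h3, h4.lt_of_ne fun h5 => h2 ?_⟩
    intro z hz
    exact LiftedCell.image_closed_subset_upperBoundary hN hc
      (show toBar f ⟨center c.cell, c.pt⟩ ∈ upperBoundary f from ⟨h1 hc.1, i, h5⟩) ⟨z, hz, rfl⟩
  · intro h
    refine ⟨fun z hz i => ?_, fun h' => ?_⟩
    · obtain h1 | ⟨h1, -⟩ := c.height_dichotomy hN i
      · have h2 := h1 z hz
        rw [h i] at h2
        simp [h2]
      · have h2 := h1 z hz
        rw [h i] at h2
        simpa using h2
    · obtain ⟨-, i, hi⟩ := h' hc.1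
      have hi : c.pt.1 i = 1 := hi
      have := h i
      rw [hi, Int.floor_one] at this
      exact one_ne_zero this

variable (f) in
/-- `K_0 ⊗ D_*` is the cellular complex of the pair `(X̄₀, N̄₀⁺)`: a face of a cell of the fundamental
domain is either in the domain, but not in `N̄₀⁺`, and then the windings from the cell to the face
vanish, or it is in `N̄₀⁺`, and then one of them is positive. -/
def originModel : SpecializationModel f E (0 : Fin s → K) (F := barFunctor f) (scalarSystem K E)
    (toBar f ⁻¹' domain f) (toBar f ⁻¹' upperBoundary f) where
  pt e := stdPoint f (center e)
  inPair e := (LiftedCell.inPair_domain_iff hN _).2 fun i => floor_stdPoint _ i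
  eq_pt e p h := eq_stdPoint p ((LiftedCell.inPair_domain_iff hN _).1 h)
  stalk x := LinearEquiv.refl K _
  faceChain_eq e e' h y := by
    let c : LiftedCell (barFunctor f) _ := ⟨e, stdPoint f (center e)⟩
    have hfl : ∀ i, ⌊(c.face e' h).pt.1 i⌋ = wind f (faceHom e e' h) i := fun i => by
      rw [wind_eq _ (stdPoint f (center e)), floor_stdPoint, sub_zero]
      rfl
    refine (faceChain_eq c e' h _).trans ?_
    by_cases h0 : ∀ i, wind f (faceHom e e' h) i = 0
    · have hin : (c.face e' h).InPair (toBar f ⁻¹' domain f) (toBar f ⁻¹' upperBoundary f) :=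
        (LiftedCell.inPair_domain_iff hN _).2 fun i => (hfl i).trans (h0 i)
      have h1 : wind f (faceHom e e' h) = 0 := funext h0
      rw [h1, power_zero, one_smul]
      refine (LinearMap.congr_fun (singleOrZero_of_inPair hin) _).trans ?_
      exact single_congr _ _ _ (eq_stdPoint _ fun i => (hfl i).trans (h0 i)) _ _ _
    · have hout : ¬ (c.face e' h).InPair (toBar f ⁻¹' domain f) (toBar f ⁻¹' upperBoundary f) :=
        fun h1 => h0 fun i => (hfl i).symm.trans ((LiftedCell.inPair_domain_iff hN _).1 h1 i)
      obtain ⟨i, hi⟩ := not_forall.1 h0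
      have h1 : power (0 : Fin s → K) (wind f (faceHom e e' h)) = 0 := by
        refine Finset.prod_eq_zero (Finset.mem_univ i) (zero_pow ?_)
        have := wind_faceHom_nonneg hN h i
        omega
      rw [h1, zero_smul]
      exact LinearMap.congr_fun (singleOrZero_of_not hout) _

end Origin

end NovikovHomology

end

theorem theorem4p2p1 {X : Type*} [TopologicalSpace X] [T2Space X] [PathConnectedSpace X]
    [CWComplex (Set.univ : Set X)] [RelCWComplex.Finite (Set.univ : Set X)]
    [NovikovHomology.IsRegularCW X] (N : NovikovHomology.Incidence X)
    {s : ℕ} (f : Fin s → C(X, UnitAddCircle)) (z₀ : NovikovHomology.Bar f)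
    (hf : ∀ j : Fin s, ∃ l : NovikovHomology.PiOne z₀,
      NovikovHomology.PiOne.deg z₀ l = Pi.single j 1)
    (hN : ∀ (i : Fin s) (q : ℕ) (e : NovikovHomology.Cell X q),
      (NovikovHomology.openCell e ∩ f i ⁻¹' {0}).Nonempty →
        NovikovHomology.openCell e ⊆ f i ⁻¹' {0})
    (E : FundamentalGroupoid X ⥤ ModuleCat.{0} ℤ)
    (hfree : ∀ x, Module.Free ℤ (E.obj x)) (hfin : ∀ x, Module.Finite ℤ (E.obj x)) :
    (∀ (a : Fin s → ℂˣ) (q : ℕ), Nonempty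
      ((NovikovHomology.evalComplex N z₀ E ℂ (fun i => (a i : ℂ))).homology q ≅
        (NovikovHomology.localComplex N
          (NovikovHomology.powerSystem f a ⊗ NovikovHomology.scalarSystem ℂ E)).homology q)) ∧
    (∀ κ : NovikovHomology.Collar f,
      (∀ p : ℕ, p.Prime → ∀ q : ℕ, Nonempty
        ((NovikovHomology.evalComplex N z₀ E (ZMod p) 0).homology q ≅
          (NovikovHomology.barComplex f N (NovikovHomology.scalarSystem (ZMod p) E)
            (NovikovHomology.domain f) κ.carrier).homology q)) ∧
      (∀ q : ℕ, Nonempty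
        ((NovikovHomology.evalComplex N z₀ E ℂ 0).homology q ≅
          (NovikovHomology.barComplex f N (NovikovHomology.scalarSystem ℂ E)
            (NovikovHomology.domain f) κ.carrier).homology q))) := by
  have key : ∀ (κ : NovikovHomology.Collar f) (K : Type) [CommRing K] (q : ℕ), Nonempty
      ((NovikovHomology.evalComplex N z₀ E K 0).homology q ≅
        (NovikovHomology.barComplex f N (NovikovHomology.scalarSystem K E)
          (NovikovHomology.domain f) κ.carrier).homology q) := fun κ K _ q => by
    obtain ⟨φ⟩ := NovikovHomology.Collar.nonempty_homology_iso hN N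
      (NovikovHomology.scalarSystem K E) κ q
    exact ⟨(HomologicalComplex.homologyFunctor _ _ q).mapIso
      ((NovikovHomology.originModel f hN E K).complexIso z₀ hN hf N) ≪≫ φ⟩
  refine ⟨fun a q => ⟨(HomologicalComplex.homologyFunctor _ _ q).mapIso
    ((NovikovHomology.torusModel f hN E a).complexIso z₀ hN hf N)⟩, fun κ => ?_⟩
  exact ⟨fun p _ q => key κ (ZMod p) q, fun q => key κ ℂ q⟩
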